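/- For i.i.d. real random variables $X_1,X_2,\dots$ put $S_n=X_1+\cdots+X_n$, $S_n^{(2)}=S_1+\cdots+S_n$ and $p_n^{(2)}=\mathbb P\big(\max_{1\le k\le n}S_k^{(2)}<0\big)$. Write $a_n\asymp b_n$ if there are constants $C_1,C_2>0$ with $C_1a_n\le b_n\le C_2a_n$ for all $n\ge 1$. (a) For every $0<\gamma<1/4$ there is an integrable, zero-mean random variable $X_1$ such that, for i.i.d. copies $X_1,X_2,\dots$ of it, $p_n^{(2)}\asymp n^{-\gamma}$. (b) Explicitly, let $1<\alpha<2$, let $Y_1,Y_2,\dots$ be i.i.d. with $\mathbb P(Y_1>y)=y^{-\alpha}$ for all $y\ge 1$, and let $X_i=Y_i-\mathbb E Y_1$. Then $Y_1$ and $X_1$ are integrable, $\mathbb E X_1=0$, the sequence $n^{-1/\alpha}\,\mathbb E|S_n|$ converges to a finite and strictly positive limit as $n\to\infty$, $\mathbb E|S_n|\asymp n^{1/\alpha}$, and $$p_n^{(2)}\asymp n^{-\gamma}\qquad\text{with}\qquad \gamma=\tfrac12\Big(1-\tfrac1\alpha\Big).$$ -/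

import Mathlib

open MeasureTheory ProbabilityTheory Filter Topology

/-- A sequence of (real) i.i.d. random variables on `(Ω, P)`.
The variable `X i` plays the role of the `(i+1)`-st variable of the sequence `X₁, X₂, …`. -/
structure IsIIDSeq {Ω : Type*} [MeasurableSpace Ω] (P : Measure Ω) (X : ℕ → Ω → ℝ) : Prop where
  measurable : ∀ i, Measurable (X i)
  indep : iIndepFun X P
  identDistrib : ∀ i, IdentDistrib (X i) (X 0) P P

/-- The partial sum `S_n` of the first `n` variables. -/
def partialSum {Ω : Type*} (X : ℕ → Ω → ℝ) (n : ℕ) (ω : Ω) : ℝ :=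
  ∑ i ∈ Finset.range n, X i ω

/-- The iterated partial sum `S_n^{(2)} = S_1 + ⋯ + S_n`. -/
def iteratedSum {Ω : Type*} (X : ℕ → Ω → ℝ) (n : ℕ) (ω : Ω) : ℝ :=
  ∑ k ∈ Finset.Icc 1 n, partialSum X k ω

/-- The persistence probability `p_n^{(2)} = P (max_{1 ≤ k ≤ n} S_k^{(2)} < 0)`. -/
noncomputable def persistenceProb {Ω : Type*} [MeasurableSpace Ω] (P : Measure Ω)
    (X : ℕ → Ω → ℝ) (n : ℕ) : ℝ :=
  P.real {ω | ∀ k ∈ Finset.Icc 1 n, iteratedSum X k ω < 0}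

/-- `a_n ≍ b_n`: the two sequences are comparable, up to positive constant factors,
for all `n ≥ 1`. -/
def SameOrder (a b : ℕ → ℝ) : Prop :=
  ∃ C₁ > 0, ∃ C₂ > 0, ∀ n : ℕ, 1 ≤ n → C₁ * a n ≤ b n ∧ b n ≤ C₂ * a n

/-! For a path `x` and a slope `t`, consider where `isum x j - t * j` is maximal over `0 ≤ j ≤ N`.
Around an index `k`, the iterated sums split into a right part driven by the shifted sequence and a
left part driven by the reversed one. If both parts stay negative, then `k` is the strict maximizer
for every `t` in the interval from `psum x (k + 1)` to `psum x k`, whose length is the negative part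
of `x k`. These intervals are disjoint, so their total length is bounded by the range of possible
slopes (`sum_negPart_le`). Conversely, every slope between `psum x N` and `psum x 1` has a
maximizer, so the intervals cover once the barrier `0` is relaxed to a line (`max_psum_sub_le`).

The left part, `x k` and the right part are independent, and reversal and shift preserve the law of
an i.i.d. sequence. Taking expectations therefore bounds convolutions of the persistence
probabilities `p` above and below by quantities of the order of E|S_n|. If E|S_n| has order `n ^ b`,
the upper bound and monotonicity give `p_n ^ 2 ≲ n ^ (b - 1)`. Inserting this into the lower bound
gives the matching estimate, so the exponent is `(1 - b) / 2`. The relaxed barrier costs only a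
constant factor: finitely many steps below `-δ` at the start absorb it (`negUpTo_of_belowUpTo`).

For centred Pareto variables, `b = 1 / α` follows from writing E|S_n| as an integral of the
characteristic function (`integral_abs_mul_cosKernel`), from the expansion `1 + t ^ α * paretoRem α
m t`, and from dominated convergence. Every exponent in (0, 1/4) arises as `α` runs through (1, 2).
-/

/-! ### Pathwise inequalities: maximizers of iterated sums with drift -/

/-- The partial sums of a real sequence. -/
def psum (x : ℕ → ℝ) (n : ℕ) : ℝ := ∑ i ∈ Finset.range n, x i

/-- The iterated partial sums of a real sequence. -/
def isum (x : ℕ → ℝ) (n : ℕ) : ℝ := ∑ k ∈ Finset.Icc 1 n, psum x k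

@[simp] lemma psum_zero (x : ℕ → ℝ) : psum x 0 = 0 := by simp [psum]

lemma psum_succ (x : ℕ → ℝ) (n : ℕ) : psum x (n + 1) = psum x n + x n := by
  simp [psum, Finset.sum_range_succ]

@[simp] lemma isum_zero (x : ℕ → ℝ) : isum x 0 = 0 := by simp [isum]

lemma isum_succ (x : ℕ → ℝ) (n : ℕ) : isum x (n + 1) = isum x n + psum x (n + 1) := by
  simp [isum, Finset.sum_Icc_succ_top]

lemma psum_congr {x y : ℕ → ℝ} {n : ℕ} (h : ∀ i < n, x i = y i) : psum x n = psum y n :=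
  Finset.sum_congr rfl fun i hi => h i (Finset.mem_range.1 hi)

lemma isum_congr {x y : ℕ → ℝ} {n : ℕ} (h : ∀ i < n, x i = y i) : isum x n = isum y n :=
  Finset.sum_congr rfl fun k hk => psum_congr fun i hi =>
    h i (lt_of_lt_of_le hi (Finset.mem_Icc.1 hk).2)

/-- The sequence with its first `a` terms removed. -/
def shiftSeq (a : ℕ) (x : ℕ → ℝ) : ℕ → ℝ := fun l => x (a + l)

/-- The permutation of `ℕ` that reverses `{0, …, k - 1}`. -/
def revIdx (k l : ℕ) : ℕ := if l < k then k - 1 - l else l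

lemma revIdx_injective (k : ℕ) : Function.Injective (revIdx k) := by
  intro a b h
  unfold revIdx at h
  split_ifs at h <;> omega

/-- The sequence with its first `k` terms reversed. -/
def revSeq (k : ℕ) (x : ℕ → ℝ) : ℕ → ℝ := fun l => x (revIdx k l)

lemma psum_add (x : ℕ → ℝ) (a j : ℕ) : psum x (a + j) = psum x a + psum (shiftSeq a x) j := by
  simp [psum, shiftSeq, Finset.sum_range_add]

/-- After time `a` the walk starts from height `psum x a`, which contributes a linear term to the
iterated sum. -/
lemma isum_add (x : ℕ → ℝ) (a j : ℕ) :
    isum x (a + j) = isum x a + j * psum x a + isum (shiftSeq a x) j := by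
  induction j with
  | zero => simp
  | succ j ih =>
    rw [← add_assoc, isum_succ, isum_succ, ih, add_assoc a j 1, psum_add]
    push_cast; ring

lemma psum_sub_revSeq (x : ℕ → ℝ) (k j : ℕ) (h : j ≤ k) :
    psum x k = psum x (k - j) + psum (revSeq k x) j := by
  induction j with
  | zero => simp
  | succ j ih =>
    rw [ih (by omega), psum_succ (revSeq k x), show k - j = (k - (j + 1)) + 1 by omega, psum_succ]
    have : revSeq k x j = x (k - (j + 1)) := by
      unfold revSeq revIdx
      rw [if_pos (by omega)]
      congr 1; omega
    rw [this]; ring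

/-- Going back `i + 1` steps from `k` involves only `i` reversed variables, because the first step
back subtracts `psum x k` itself. Hence the left event at `k` has horizon `k - 1`. -/
lemma isum_sub_revSeq (x : ℕ → ℝ) (k i : ℕ) (h : i + 1 ≤ k) :
    isum x k = isum x (k - (i + 1)) + (i + 1) * psum x k - isum (revSeq k x) i := by
  induction i with
  | zero =>
    obtain ⟨k, rfl⟩ : ∃ m, k = m + 1 := ⟨k - 1, by omega⟩
    simp [isum_succ]
  | succ i ih =>
    rw [ih (by omega), isum_succ (revSeq k x), show k - (i + 1) = (k - (i + 1 + 1)) + 1 by omega,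
      isum_succ, psum_sub_revSeq x k (i + 1) (by omega),
      show k - (i + 1) = (k - (i + 1 + 1)) + 1 by omega]
    push_cast; ring

/-- The iterated sums up to index `m` are negative. -/
def NegUpTo (m : ℕ) (x : ℕ → ℝ) : Prop := ∀ j ∈ Finset.Icc 1 m, isum x j < 0

/-- The iterated sums up to index `m` stay weakly below the line through `0` of slope `c`. -/
def BelowUpTo (c : ℝ) (m : ℕ) (x : ℕ → ℝ) : Prop := ∀ j ∈ Finset.Icc 1 m, isum x j ≤ c * j

/-- Index `k` strictly maximizes the iterated sums with drift `-t`. -/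
lemma isum_drift_lt {x : ℕ → ℝ} {N k : ℕ} (hk : 1 ≤ k) (hkN : k + 1 ≤ N)
    (hL : NegUpTo (k - 1) (revSeq k x)) (hR : NegUpTo (N - k - 1) (shiftSeq (k + 1) x))
    {t : ℝ} (h1 : psum x (k + 1) < t) (h2 : t < psum x k) {j : ℕ} (hj : j ≤ N) (hjk : j ≠ k) :
    isum x j - t * j < isum x k - t * k := by
  rcases lt_or_gt_of_ne hjk with h | h
  · obtain ⟨i, rfl⟩ : ∃ i, k = j + (i + 1) := ⟨k - j - 1, by omega⟩
    have h3 := isum_sub_revSeq x (j + (i + 1)) i (by omega)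
    rw [show j + (i + 1) - (i + 1) = j by omega] at h3
    have h4 : isum (revSeq (j + (i + 1)) x) i ≤ 0 := by
      rcases Nat.eq_zero_or_pos i with rfl | hi
      · simp
      · exact (hL i (Finset.mem_Icc.2 ⟨hi, by omega⟩)).le
    have h5 : 0 < ((i : ℝ) + 1) * (psum x (j + (i + 1)) - t) :=
      mul_pos (by positivity) (by linarith)
    push_cast
    nlinarith
  · obtain ⟨i, rfl⟩ : ∃ i, j = k + 1 + i := ⟨j - k - 1, by omega⟩
    have h3 := isum_add x (k + 1) i
    rw [isum_succ] at h3
    have h4 : isum (shiftSeq (k + 1) x) i ≤ 0 := by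
      rcases Nat.eq_zero_or_pos i with rfl | hi
      · simp
      · exact (hR i (Finset.mem_Icc.2 ⟨hi, by omega⟩)).le
    have h5 : 0 < ((i : ℝ) + 1) * (t - psum x (k + 1)) :=
      mul_pos (by positivity) (by linarith)
    push_cast
    nlinarith

lemma abs_isum_sub_le (x : ℕ → ℝ) {a b N : ℕ} (hab : a ≤ b) (hb : b ≤ N) :
    |isum x b - isum x a| ≤ ∑ j ∈ Finset.range (N + 1), |psum x j| := by
  have : isum x b - isum x a = ∑ j ∈ Finset.Ioc a b, psum x j := by
    induction b, hab using Nat.le_induction with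
    | base => simp
    | succ b hab ih =>
      rw [Finset.sum_Ioc_succ_top hab, ← ih (by omega), isum_succ]; ring
  rw [this]
  refine (Finset.abs_sum_le_sum_abs _ _).trans
    (Finset.sum_le_sum_of_subset_of_nonneg ?_ fun _ _ _ => abs_nonneg _)
  intro j hj
  simp only [Finset.mem_Ioc, Finset.mem_range] at *
  omega

open Classical in
/-- Upper bound for the total weight of the positions where both one-sided events occur. -/
lemma sum_negPart_le (x : ℕ → ℝ) {n : ℕ} (hn : 1 ≤ n) :
    ∑ k ∈ Finset.Icc n (2 * n),
      (if NegUpTo (k - 1) (revSeq k x) ∧ NegUpTo (3 * n - k - 1) (shiftSeq (k + 1) x)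
        then max (-x k) 0 else 0) ≤
      2 / n * ∑ j ∈ Finset.range (3 * n + 1), |psum x j| := by
  set T := ∑ j ∈ Finset.range (3 * n + 1), |psum x j| with hT
  have hT0 : 0 ≤ T := Finset.sum_nonneg fun _ _ => abs_nonneg _
  have hn' : (0 : ℝ) < n := by exact_mod_cast hn
  -- The slopes for which `k` is certified to be the strict maximizer; two indices cannot share a
  -- slope.
  let I : ℕ → Set ℝ := fun k =>
    if NegUpTo (k - 1) (revSeq k x) ∧ NegUpTo (3 * n - k - 1) (shiftSeq (k + 1) x)
      then Set.Ioo (psum x (k + 1)) (psum x k) else ∅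
  have hmeas : ∀ k, MeasurableSet (I k) := fun k => by
    simp only [I]; split_ifs
    · exact measurableSet_Ioo
    · exact MeasurableSet.empty
  have hmem : ∀ k ∈ Finset.Icc n (2 * n), ∀ t ∈ I k, ∀ j ≤ 3 * n, j ≠ k →
      isum x j - t * j < isum x k - t * k := by
    intro k hk t ht j hj hjk
    rw [Finset.mem_Icc] at hk
    simp only [I] at ht
    split_ifs at ht with h
    · exact isum_drift_lt (by omega) (by omega) h.1 h.2 ht.1 ht.2 hj hjk
    · exact ht.elim
  have hdisj : (↑(Finset.Icc n (2 * n)) : Set ℕ).PairwiseDisjoint I := by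
    intro k hk l hl hkl
    refine Set.disjoint_left.2 fun t htk htl => ?_
    have hk' := Finset.mem_Icc.1 hk
    have hl' := Finset.mem_Icc.1 hl
    exact lt_asymm (hmem k hk t htk l (by omega) hkl.symm) (hmem l hl t htl k (by omega) hkl)
  -- Indices in the middle third are at distance at least `n` from both `0` and `3 * n`. Comparing
  -- the maximum with these two endpoints gives `|t| * n ≤ T`.
  have hsub : (⋃ k ∈ Finset.Icc n (2 * n), I k) ⊆ Set.Icc (-(T / n)) (T / n) := by
    refine Set.iUnion₂_subset fun k hk t ht => ?_
    have hk' := Finset.mem_Icc.1 hk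
    have hkn : (n : ℝ) ≤ k := by exact_mod_cast hk'.1
    have hkn2 : (k : ℝ) ≤ 2 * n := by exact_mod_cast hk'.2
    have h1 := hmem k hk t ht 0 (by omega) (by omega)
    have h2 := hmem k hk t ht (3 * n) le_rfl (by omega)
    have h3 := (abs_le.1 (abs_isum_sub_le x (a := 0) (b := k) (N := 3 * n) (by omega) (by omega))).2
    have h4 := (abs_le.1 (abs_isum_sub_le x (a := k) (b := 3 * n) (N := 3 * n)
      (by omega) le_rfl)).1
    rw [← hT] at h3 h4
    simp only [isum_zero] at h1 h3
    push_cast at h2 h1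
    constructor
    · rw [neg_le, div_eq_mul_inv, ← div_eq_mul_inv, le_div_iff₀ hn']
      by_contra hc
      push Not at hc
      have : 0 < -t := by nlinarith
      nlinarith [mul_nonneg this.le (by linarith : (0 : ℝ) ≤ 2 * n - k)]
    · rw [le_div_iff₀ hn']
      by_contra hc
      push Not at hc
      have : 0 < t := by nlinarith
      nlinarith [mul_nonneg this.le (by linarith : (0 : ℝ) ≤ k - n)]
  have hvol : ∀ k, (if NegUpTo (k - 1) (revSeq k x) ∧
      NegUpTo (3 * n - k - 1) (shiftSeq (k + 1) x) then max (-x k) 0 else 0) =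
        volume.real (I k) := by
    intro k
    simp only [I]
    split_ifs
    · rw [Real.volume_real_Ioo, psum_succ]
      congr 1; ring
    · simp
  have hfin : ∀ k, volume (I k) ≠ ⊤ := fun k => by
    simp only [I]
    split_ifs
    · simp
    · simp
  calc _ = ∑ k ∈ Finset.Icc n (2 * n), volume.real (I k) := Finset.sum_congr rfl fun k _ => hvol k
    _ = volume.real (⋃ k ∈ Finset.Icc n (2 * n), I k) :=
      (measureReal_biUnion_finset hdisj (fun k _ => hmeas k) (fun k _ => hfin k)).symm
    _ ≤ volume.real (Set.Icc (-(T / n)) (T / n)) := measureReal_mono hsub (by simp)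
    _ = 2 / n * T := by
      rw [Real.volume_real_Icc_of_le (by linarith [div_nonneg hT0 hn'.le])]
      ring

open Classical in
/-- Lower bound for the total weight of the positions where both relaxed one-sided events occur. -/
lemma max_psum_sub_le (x : ℕ → ℝ) {N : ℕ} {B : ℝ} (hN : 2 ≤ N) (hB : ∀ i, -B ≤ x i)
    (hB0 : 0 ≤ B) :
    max (psum x 1 - psum x N) 0 ≤ ∑ k ∈ Finset.Icc 1 (N - 1),
      (if BelowUpTo (2 * B) (k - 1) (revSeq k x) ∧
          BelowUpTo (2 * B) (N - k - 1) (shiftSeq (k + 1) x)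
        then max (-x k) 0 else 0) := by
  let J : ℕ → Set ℝ := fun k =>
    if BelowUpTo (2 * B) (k - 1) (revSeq k x) ∧ BelowUpTo (2 * B) (N - k - 1) (shiftSeq (k + 1) x)
      then Set.Icc (psum x (k + 1)) (psum x k) else ∅
  -- A maximizer exists for every slope; `t < psum x 1` excludes index `0`, and `psum x N < t`
  -- excludes index `N`.
  have hsub : Set.Ioo (psum x N) (psum x 1) ⊆ ⋃ k ∈ Finset.Icc 1 (N - 1), J k := by
    intro t ht
    obtain ⟨k, hk, hmax⟩ := Finset.exists_max_image (Finset.range (N + 1))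
      (fun j : ℕ => isum x j - t * j) ⟨0, by simp⟩
    simp only [Finset.mem_range] at hk hmax
    have hk0 : k ≠ 0 := by
      rintro rfl
      have := hmax 1 (by omega)
      rw [show (1 : ℕ) = 0 + 1 from rfl, isum_succ] at this
      simp only [isum_zero] at this
      push_cast at this
      have := ht.2
      simp only [zero_add] at *
      linarith
    have hkN : k ≠ N := by
      rintro rfl
      have := hmax (k - 1) (by omega)
      obtain ⟨l, rfl⟩ : ∃ l, k = l + 1 := ⟨k - 1, by omega⟩
      rw [isum_succ, Nat.add_sub_cancel] at this
      push_cast at this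
      linarith [ht.1]
    have h1 : t ≤ psum x k := by
      have := hmax (k - 1) (by omega)
      obtain ⟨l, rfl⟩ : ∃ l, k = l + 1 := ⟨k - 1, by omega⟩
      rw [isum_succ, Nat.add_sub_cancel] at this
      push_cast at this
      linarith
    have h2 : psum x (k + 1) ≤ t := by
      have := hmax (k + 1) (by omega)
      rw [isum_succ] at this
      push_cast at this
      linarith
    -- The slope interval at `k` has length `-x k ≤ B`. Each one-sided walk is thus at most `(i + 1)
    -- * B ≤ 2 * B * i` for `i ≥ 1`, hence the barrier slope `2 * B`.
    have h3 : psum x k - t ≤ B := by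
      have := hB k
      rw [psum_succ] at h2
      linarith
    have h4 : t - psum x (k + 1) ≤ B := by
      have := hB k
      rw [psum_succ]
      linarith
    refine Set.mem_iUnion₂.2 ⟨k, Finset.mem_Icc.2 ⟨by omega, by omega⟩, ?_⟩
    simp only [J]
    rw [if_pos]
    · exact ⟨h2, h1⟩
    constructor
    · intro i hi
      rw [Finset.mem_Icc] at hi
      have h5 := isum_sub_revSeq x k i (by omega)
      have h6 := hmax (k - (i + 1)) (by omega)
      rw [Nat.cast_sub (by omega)] at h6
      push_cast at h6
      have h7 : (1 : ℝ) ≤ i := by exact_mod_cast hi.1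
      have h8 := mul_le_mul_of_nonneg_left h3 (by positivity : (0 : ℝ) ≤ i + 1)
      nlinarith
    · intro i hi
      rw [Finset.mem_Icc] at hi
      have h5 := isum_add x (k + 1) i
      rw [isum_succ] at h5
      have h6 := hmax (k + 1 + i) (by omega)
      push_cast at h6
      have h7 : (1 : ℝ) ≤ i := by exact_mod_cast hi.1
      have h8 := mul_le_mul_of_nonneg_left h4 (by positivity : (0 : ℝ) ≤ i + 1)
      nlinarith
  have hvol : ∀ k, (if BelowUpTo (2 * B) (k - 1) (revSeq k x) ∧
      BelowUpTo (2 * B) (N - k - 1) (shiftSeq (k + 1) x) then max (-x k) 0 else 0) =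
        volume.real (J k) := by
    intro k
    simp only [J]
    split_ifs
    · rw [Real.volume_real_Icc, psum_succ]
      congr 1; ring
    · simp
  have hfin : ∀ k, volume (J k) ≠ ⊤ := fun k => by
    simp only [J]
    split_ifs
    · simp
    · simp
  calc max (psum x 1 - psum x N) 0 = volume.real (Set.Ioo (psum x N) (psum x 1)) := by
        rw [Real.volume_real_Ioo]
    _ ≤ volume.real (⋃ k ∈ Finset.Icc 1 (N - 1), J k) :=
      measureReal_mono hsub
        ((measure_biUnion_lt_top (Finset.finite_toSet _) fun k _ => (hfin k).lt_top).ne)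
    _ ≤ ∑ k ∈ Finset.Icc 1 (N - 1), volume.real (J k) := measureReal_biUnion_finset_le _ _
    _ = _ := Finset.sum_congr rfl fun k _ => (hvol k).symm

lemma NegUpTo.mono {m n : ℕ} {x : ℕ → ℝ} (hmn : m ≤ n) (h : NegUpTo n x) : NegUpTo m x :=
  fun j hj => h j (Finset.Icc_subset_Icc_right hmn hj)

/-- Sufficiently negative initial terms turn a linear barrier into the barrier `0`. -/
lemma negUpTo_of_belowUpTo {x : ℕ → ℝ} {r m : ℕ} {c δ : ℝ} (hδ : 0 < δ)
    (hr : c ≤ r * δ) (hx : ∀ i < r, x i ≤ -δ) (hb : BelowUpTo c m (shiftSeq r x)) (hr1 : 1 ≤ r) :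
    NegUpTo m x := by
  have hps : ∀ k ≤ r, psum x k ≤ -(k * δ) := fun k hk => by
    calc psum x k ≤ ∑ i ∈ Finset.range k, -δ :=
          Finset.sum_le_sum fun i hi => hx i (by have := Finset.mem_range.1 hi; omega)
      _ = -(k * δ) := by simp
  have his : ∀ k ≤ r, 1 ≤ k → isum x k < 0 := fun k hk hk1 =>
    Finset.sum_neg (fun j hj => by
      rw [Finset.mem_Icc] at hj
      have := hps j (by omega)
      have : (0 : ℝ) < j * δ := mul_pos (by exact_mod_cast hj.1) hδ
      linarith) ⟨1, by simp [hk1]⟩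
  intro j hj
  rw [Finset.mem_Icc] at hj
  rcases le_total j r with h | h
  · exact his j h hj.1
  · obtain ⟨i, rfl⟩ := Nat.exists_eq_add_of_le h
    rw [isum_add]
    have h1 : isum (shiftSeq r x) i ≤ c * i := by
      rcases Nat.eq_zero_or_pos i with rfl | hi
      · simp
      · exact hb i (Finset.mem_Icc.2 ⟨hi, by omega⟩)
    -- After `r` steps the walk is at most `-(r * δ) ≤ -c`, which cancels the allowed growth `c *
    -- i`; the strict sign comes from `isum x r < 0`.
    have h2 := mul_le_mul_of_nonneg_left (hps r le_rfl) (Nat.cast_nonneg (α := ℝ) i)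
    have h3 := his r le_rfl hr1
    have h4 := mul_le_mul_of_nonneg_left hr (Nat.cast_nonneg (α := ℝ) i)
    nlinarith

/-! ### Measurability and dependence on finitely many coordinates -/

@[fun_prop]
lemma measurable_psum (n : ℕ) : Measurable fun x : ℕ → ℝ => psum x n := by
  unfold psum; fun_prop

@[fun_prop]
lemma measurable_isum (n : ℕ) : Measurable fun x : ℕ → ℝ => isum x n := by
  unfold isum; fun_prop

@[fun_prop]
lemma measurable_revSeq (k : ℕ) : Measurable (revSeq k) := by
  unfold revSeq; fun_prop

@[fun_prop]
lemma measurable_shiftSeq (k : ℕ) : Measurable (shiftSeq k) := by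
  unfold shiftSeq; fun_prop

lemma measurableSet_negUpTo (m : ℕ) : MeasurableSet {x | NegUpTo m x} := by
  simp only [NegUpTo, Set.ofPred_forall]
  exact Finset.measurableSet_biInter _ fun j _ =>
    measurableSet_lt (measurable_isum j) measurable_const

lemma measurableSet_belowUpTo (c : ℝ) (m : ℕ) : MeasurableSet {x | BelowUpTo c m x} := by
  simp only [BelowUpTo, Set.ofPred_forall]
  exact Finset.measurableSet_biInter _ fun j _ =>
    measurableSet_le (measurable_isum j) measurable_const

lemma dependsOn_negUpTo (m : ℕ) : DependsOn (NegUpTo m) (Finset.range m) := by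
  intro x y h
  refine propext (forall₂_congr fun j hj => ?_)
  rw [isum_congr fun i hi => h i (by simp at *; omega)]

lemma dependsOn_belowUpTo (c : ℝ) (m : ℕ) : DependsOn (BelowUpTo c m) (Finset.range m) := by
  intro x y h
  refine propext (forall₂_congr fun j hj => ?_)
  rw [isum_congr fun i hi => h i (by simp at *; omega)]

/-! ### Independence: from paths to convolution inequalities -/

section IID

variable {Ω : Type*} [MeasurableSpace Ω] {P : Measure Ω}
  {X : ℕ → Ω → ℝ}

lemma IsIIDSeq.precomp (h : IsIIDSeq P X) {σ : ℕ → ℕ} (hσ : Function.Injective σ) :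
    IsIIDSeq P fun i => X (σ i) :=
  ⟨fun i => h.measurable _, h.indep.precomp hσ,
    fun i => (h.identDistrib _).trans (h.identDistrib _).symm⟩

/-- Both laws are the same infinite product. Reversal and shift are injective reindexings, so the
one-sided events have the probabilities of the original ones. -/
lemma IsIIDSeq.identDistrib_precomp (h : IsIIDSeq P X) {σ : ℕ → ℕ} (hσ : Function.Injective σ) :
    IdentDistrib (fun ω i => X (σ i) ω) (fun ω i => X i ω) P P where
  aemeasurable_fst := (measurable_pi_iff.2 fun i => h.measurable _).aemeasurable
  aemeasurable_snd := (measurable_pi_iff.2 fun i => h.measurable _).aemeasurable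
  map_eq := by
    rw [(h.precomp hσ).indep.map_fun_eq_infinitePi_map fun i => h.measurable _,
      h.indep.map_fun_eq_infinitePi_map h.measurable]
    congr 1
    ext1 i
    exact ((h.identDistrib _).trans (h.identDistrib _).symm).map_eq

lemma IsIIDSeq.indepFun_of_dependsOn (h : IsIIDSeq P X) {S T : Finset ℕ} (hST : Disjoint S T)
    {F G : (ℕ → ℝ) → ℝ} (hF : Measurable F) (hG : Measurable G) (hFS : DependsOn F S)
    (hGT : DependsOn G T) :
    IndepFun (fun ω => F fun i => X i ω) (fun ω => G fun i => X i ω) P := by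
  classical
  -- Extension by zero: a functional depending only on `S` does not see the filled-in values, so it
  -- factors through the finite block.
  let e : ∀ S : Finset ℕ, (S → ℝ) → ℕ → ℝ := fun S x i => if hi : i ∈ S then x ⟨i, hi⟩ else 0
  have he : ∀ S, Measurable (e S) := fun S => by
    refine measurable_pi_iff.2 fun i => ?_
    by_cases hi : i ∈ S
    · simp only [e, hi, dif_pos]; fun_prop
    · simp only [e, hi, dif_neg, not_false_eq_true]; fun_prop
  have key : ∀ (S : Finset ℕ) (F : (ℕ → ℝ) → ℝ), DependsOn F S →
      (fun ω => F fun i => X i ω) = (F ∘ e S) ∘ fun ω (i : S) => X i ω := fun S F hF => by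
    ext ω
    refine hF fun i hi => ?_
    have hi' : i ∈ S := hi
    simp [e, hi']
  rw [key S F hFS, key T G hGT]
  exact (h.indep.indepFun_finset S T hST h.measurable).comp (hF.comp (he S)) (hG.comp (he T))

lemma IsIIDSeq.measurable_seq (h : IsIIDSeq P X) : Measurable fun ω i => X i ω :=
  measurable_pi_iff.2 fun i => h.measurable i

lemma IsIIDSeq.integral_indicator_one_comp (h : IsIIDSeq P X) {A : Set (ℕ → ℝ)}
    (hA : MeasurableSet A) :
    ∫ ω, A.indicator 1 (fun i => X i ω) ∂P = P.real {ω | (fun i => X i ω) ∈ A} :=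
  integral_indicator_one (μ := P) (h.measurable_seq hA)

lemma IsIIDSeq.integrable_indicator_one_comp [IsProbabilityMeasure P] (h : IsIIDSeq P X)
    {A : Set (ℕ → ℝ)} (hA : MeasurableSet A) :
    Integrable (fun ω => A.indicator (1 : (ℕ → ℝ) → ℝ) (fun i => X i ω)) P :=
  (integrable_const (1 : ℝ)).indicator (h.measurable_seq hA)

lemma IsIIDSeq.integral_mul_mul (h : IsIIDSeq P X) {k N : ℕ} {F G : (ℕ → ℝ) → ℝ} {u : ℝ → ℝ}
    (hF : Measurable F) (hG : Measurable G) (hu : Measurable u)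
    (hFk : DependsOn F (Finset.range k)) (hGk : DependsOn G (Finset.Ico (k + 1) N)) :
    ∫ ω, F (fun i => X i ω) * (G (fun i => X i ω) * u (X k ω)) ∂P =
      (∫ ω, F (fun i => X i ω) ∂P) * ((∫ ω, G (fun i => X i ω) ∂P) * ∫ ω, u (X 0 ω) ∂P) := by
  have hX := h.measurable_seq
  have hu' : Measurable fun x : ℕ → ℝ => u (x k) := hu.comp (measurable_pi_apply k)
  have hdu : DependsOn (fun x : ℕ → ℝ => u (x k)) (({k} : Finset ℕ) : Set ℕ) := fun x y hxy => by
    simp only; rw [hxy k (by simp)]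
  have h1 : IndepFun (fun ω => F fun i => X i ω) (fun ω => G (fun i => X i ω) * u (X k ω)) P :=
    h.indepFun_of_dependsOn (T := Finset.Ico (k + 1) N ∪ {k})
      (G := fun x => G x * u (x k)) (by
        rw [Finset.disjoint_left]; intro i hi hi'
        simp only [Finset.mem_range, Finset.mem_union, Finset.mem_Ico, Finset.mem_singleton] at *
        omega) hF (hG.mul hu') hFk (fun x y hxy => by
        simp only
        rw [hGk.mono (by simp) hxy, hxy k (by simp)])
  have h2 : IndepFun (fun ω => G fun i => X i ω) (fun ω => u (X k ω)) P :=
    h.indepFun_of_dependsOn (T := {k}) (G := fun x => u (x k)) (by simp) hG hu' hGk hdu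
  have h3 : ∫ ω, u (X k ω) ∂P = ∫ ω, u (X 0 ω) ∂P := ((h.identDistrib k).comp hu).integral_eq
  rw [h1.integral_fun_mul_eq_mul_integral (hF.comp hX).aestronglyMeasurable
      ((hG.comp hX).mul (hu'.comp hX)).aestronglyMeasurable,
    h2.integral_fun_mul_eq_mul_integral (hG.comp hX).aestronglyMeasurable
      (hu'.comp hX).aestronglyMeasurable, h3]

open Classical in
/-- The two one-sided events around position `k` and the variable at `k` are independent. -/
lemma IsIIDSeq.integral_ite_eq (h : IsIIDSeq P X) {Q : ℕ → (ℕ → ℝ) → Prop}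
    (hQ : ∀ m, MeasurableSet {x | Q m x}) (hQd : ∀ m, DependsOn (Q m) (Finset.range m))
    {k N : ℕ} (hk : 1 ≤ k) (hkN : k + 1 ≤ N) :
    ∫ ω, (if Q (k - 1) (revSeq k fun i => X i ω) ∧ Q (N - k - 1) (shiftSeq (k + 1) fun i => X i ω)
        then max (-X k ω) 0 else 0) ∂P =
      P.real {ω | Q (k - 1) fun i => X i ω} * (P.real {ω | Q (N - k - 1) fun i => X i ω} *
        ∫ ω, max (-X 0 ω) 0 ∂P) := by
  let I : ℕ → (ℕ → ℝ) → ℝ := fun m => Set.indicator {x | Q m x} 1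
  have hI : ∀ m, Measurable (I m) := fun m => measurable_one.indicator (hQ m)
  have hint : ∀ (m : ℕ) (σ : ℕ → ℕ), Function.Injective σ →
      ∫ ω, I m (fun i => X (σ i) ω) ∂P = P.real {ω | Q m fun i => X i ω} := fun m σ hσ => by
    exact ((h.identDistrib_precomp hσ).comp (hI m)).integral_eq.trans
      (h.integral_indicator_one_comp (hQ m))
  have := h.integral_mul_mul (k := k) (N := N) (F := fun x => I (k - 1) (revSeq k x))
    (G := fun x => I (N - k - 1) (shiftSeq (k + 1) x)) (u := fun t => max (-t) 0)
    ((hI _).comp (measurable_revSeq k)) ((hI _).comp (measurable_shiftSeq _)) (by fun_prop)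
    (fun x y hxy => by
      have : Q (k - 1) (revSeq k x) = Q (k - 1) (revSeq k y) := hQd _ fun i hi => by
        have : i < k - 1 := by simpa using hi
        refine hxy _ ?_
        simp only [revIdx]
        rw [if_pos (by omega)]
        simp only [Finset.coe_range, Set.mem_Iio]
        omega
      simp only [I, Set.indicator, Set.mem_ofPred_eq, this, Pi.one_apply])
    (fun x y hxy => by
      have : Q (N - k - 1) (shiftSeq (k + 1) x) = Q (N - k - 1) (shiftSeq (k + 1) y) :=
        hQd _ fun i hi => by
          have : i < N - k - 1 := by simpa using hi
          refine hxy _ ?_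
          simp only [Finset.coe_Ico, Set.mem_Ico]
          omega
      simp only [I, Set.indicator, Set.mem_ofPred_eq, this, Pi.one_apply])
  have h1 := hint (k - 1) _ (revIdx_injective k)
  have h2 := hint (N - k - 1) (fun l => k + 1 + l) (add_right_injective (k + 1))
  rw [← h1, ← h2]
  refine Eq.trans (integral_congr_ae (ae_of_all _ fun ω => ?_)) this
  simp only [I, Set.indicator, Set.mem_ofPred_eq]
  split_ifs <;> simp_all

lemma IsIIDSeq.integrable (h : IsIIDSeq P X) (hi : Integrable (X 0) P) (i : ℕ) :
    Integrable (X i) P :=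
  (h.identDistrib i).integrable_iff.2 hi

open Classical in
lemma IsIIDSeq.integrable_ite (h : IsIIDSeq P X) (hi : Integrable (X 0) P)
    {Q : ℕ → (ℕ → ℝ) → Prop} (hQ : ∀ m, MeasurableSet {x | Q m x}) (k N : ℕ) :
    Integrable (fun ω => if Q (k - 1) (revSeq k fun i => X i ω) ∧
      Q (N - k - 1) (shiftSeq (k + 1) fun i => X i ω) then max (-X k ω) 0 else 0) P := by
  have hX := h.measurable_seq
  refine (h.integrable hi k).mono (Measurable.aestronglyMeasurable ?_) (ae_of_all _ fun ω => ?_)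
  · refine Measurable.ite ?_ (by have := h.measurable k; fun_prop) measurable_const
    exact (((measurable_revSeq k).comp hX) (hQ _)).inter
      (((measurable_shiftSeq (k + 1)).comp hX) (hQ _))
  · split_ifs
    · rw [Real.norm_eq_abs, Real.norm_eq_abs, abs_of_nonneg (le_max_right _ _)]
      exact max_le (neg_le_abs _) (abs_nonneg _)
    · simp

lemma IsIIDSeq.integrable_partialSum (h : IsIIDSeq P X) (hi : Integrable (X 0) P) (n : ℕ) :
    Integrable (partialSum X n) P :=
  integrable_finsetSum _ fun i _ => h.integrable hi i

lemma persistenceProb_eq (P : Measure Ω) (X : ℕ → Ω → ℝ) (m : ℕ) :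
    persistenceProb P X m = P.real {ω | NegUpTo m fun i => X i ω} := rfl

lemma persistenceProb_antitone [IsProbabilityMeasure P] : Antitone (persistenceProb P X) := fun _ _ hmn =>
  measureReal_mono fun _ h => NegUpTo.mono hmn h

lemma persistenceProb_nonneg (m : ℕ) : 0 ≤ persistenceProb P X m := measureReal_nonneg

/-- Expectation of `sum_negPart_le`, factored by independence. -/
lemma IsIIDSeq.sum_persistenceProb_mul_le (h : IsIIDSeq P X) (hi : Integrable (X 0) P) {n : ℕ}
    (hn : 1 ≤ n) :
    ∑ k ∈ Finset.Icc n (2 * n), persistenceProb P X (k - 1) *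
      (persistenceProb P X (3 * n - k - 1) * ∫ ω, max (-X 0 ω) 0 ∂P) ≤
      2 / n * ∑ j ∈ Finset.range (3 * n + 1), ∫ ω, |partialSum X j ω| ∂P := by
  classical
  have h1 : ∀ k ∈ Finset.Icc n (2 * n), persistenceProb P X (k - 1) *
      (persistenceProb P X (3 * n - k - 1) * ∫ ω, max (-X 0 ω) 0 ∂P) = _ := fun k hk =>
    (h.integral_ite_eq measurableSet_negUpTo dependsOn_negUpTo (k := k) (N := 3 * n)
      (by rw [Finset.mem_Icc] at hk; omega) (by rw [Finset.mem_Icc] at hk; omega)).symm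
  have h2 : ∀ j ∈ Finset.range (3 * n + 1), Integrable (fun ω => |partialSum X j ω|) P :=
    fun j _ => (h.integrable_partialSum hi j).abs
  rw [Finset.sum_congr rfl h1, ← integral_finsetSum _ fun k _ =>
    h.integrable_ite hi measurableSet_negUpTo k _, ← integral_finsetSum _ h2,
    ← integral_const_mul]
  exact integral_mono (integrable_finsetSum _ fun k _ =>
    h.integrable_ite hi measurableSet_negUpTo k _) ((integrable_finsetSum _ h2).const_mul _)
    fun ω => sum_negPart_le (fun i => X i ω) hn

/-- Expectation of `max_psum_sub_le` with `N = n + 1`. Discarding the first variable leaves a copy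
of S_n, and zero mean makes the expected negative part equal to half of E|S_n|. -/
lemma IsIIDSeq.integral_abs_partialSum_le (h : IsIIDSeq P X) (hi : Integrable (X 0) P)
    (h0 : ∫ ω, X 0 ω ∂P = 0) {B : ℝ} (hB0 : 0 ≤ B) (hB : ∀ᵐ ω ∂P, -B ≤ X 0 ω) {n : ℕ}
    (hn : 1 ≤ n) :
    (∫ ω, |partialSum X n ω| ∂P) / 2 ≤
      ∑ k ∈ Finset.Icc 1 n, P.real {ω | BelowUpTo (2 * B) (k - 1) fun i => X i ω} *
        (P.real {ω | BelowUpTo (2 * B) (n - k) fun i => X i ω} * ∫ ω, max (-X 0 ω) 0 ∂P) := by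
  classical
  have h1 : ∀ k ∈ Finset.Icc 1 n, P.real {ω | BelowUpTo (2 * B) (k - 1) fun i => X i ω} *
        (P.real {ω | BelowUpTo (2 * B) (n - k) fun i => X i ω} * ∫ ω, max (-X 0 ω) 0 ∂P) =
      ∫ ω, (if BelowUpTo (2 * B) (k - 1) (revSeq k fun i => X i ω) ∧
        BelowUpTo (2 * B) (n + 1 - k - 1) (shiftSeq (k + 1) fun i => X i ω)
        then max (-X k ω) 0 else 0) ∂P := fun k hk => by
    rw [Finset.mem_Icc] at hk
    rw [h.integral_ite_eq (measurableSet_belowUpTo (2 * B)) (dependsOn_belowUpTo (2 * B))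
      (by omega) (by omega), show n + 1 - k - 1 = n - k by omega]
  have hI := fun k => h.integrable_ite hi (measurableSet_belowUpTo (2 * B)) k (n + 1)
  have hBi : ∀ i, ∀ᵐ ω ∂P, -B ≤ X i ω := fun i =>
    ((h.identDistrib i).symm.ae_mem_snd (t := Set.Ici (-B)) measurableSet_Ici hB)
  have hs : IdentDistrib (fun ω => psum (shiftSeq 1 fun i => X i ω) n) (partialSum X n) P P :=
    (h.identDistrib_precomp (add_right_injective 1)).comp (measurable_psum n)
  have hsi : Integrable (fun ω => psum (shiftSeq 1 fun i => X i ω) n) P :=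
    hs.integrable_iff.2 (h.integrable_partialSum hi n)
  have hpm : ∀ ω, psum (fun i => X i ω) 1 - psum (fun i => X i ω) (n + 1) =
      -psum (shiftSeq 1 fun i => X i ω) n := fun ω => by
    rw [add_comm n 1, psum_add]; ring
  have h3 : ∫ ω, max (psum (fun i => X i ω) 1 - psum (fun i => X i ω) (n + 1)) 0 ∂P =
      (∫ ω, |partialSum X n ω| ∂P) / 2 := by
    simp_rw [hpm]
    have : ∀ a : ℝ, max (-a) 0 = (|a| - a) / 2 := fun a => by
      rcases le_total a 0 with ha | ha
      · rw [abs_of_nonpos ha, max_eq_left (by linarith)]; ring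
      · rw [abs_of_nonneg ha, max_eq_right (by linarith)]; ring
    simp_rw [this]
    rw [integral_div, integral_sub hsi.abs hsi, hs.integral_eq]
    have hs' := (hs.comp measurable_id.abs).integral_eq
    simp only [Function.comp_def, id] at hs'
    rw [hs']
    have : ∫ ω, partialSum X n ω ∂P = 0 := by
      simp only [partialSum]
      rw [integral_finsetSum _ fun i _ => h.integrable hi i]
      exact Finset.sum_eq_zero fun i _ => by rw [(h.identDistrib i).integral_eq, h0]
    rw [this, sub_zero]
  rw [Finset.sum_congr rfl h1, ← integral_finsetSum _ fun k _ => hI k, ← h3]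
  refine integral_mono_ae ?_ (integrable_finsetSum _ fun k _ => hI k) ?_
  · simp_rw [hpm]
    exact hsi.neg.sup (integrable_zero _ _ _)
  · filter_upwards [ae_all_iff.2 hBi] with ω hω
    exact max_psum_sub_le (fun i => X i ω) (N := n + 1) (by omega) hω hB0

lemma IsIIDSeq.measureReal_initial (h : IsIIDSeq P X) (r : ℕ) (δ : ℝ) :
    P.real {ω | ∀ i < r, X i ω ≤ -δ} = P.real {ω | X 0 ω ≤ -δ} ^ r := by
  have h1 := h.indep.measure_inter_preimage_eq_mul (Finset.range r) (sets := fun _ => Set.Iic (-δ))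
    fun _ _ => measurableSet_Iic
  have h2 : ∀ i, P (X i ⁻¹' Set.Iic (-δ)) = P {ω | X 0 ω ≤ -δ} := fun i =>
    (h.identDistrib i).measure_mem_eq measurableSet_Iic
  simp only [h2, Finset.prod_const, Finset.card_range] at h1
  rw [measureReal_def, measureReal_def, ← ENNReal.toReal_pow, ← h1]
  congr 2
  ext ω; simp

/-- Prepending `r` independent steps below `-δ` costs a factor that does not depend on `m`. -/
lemma IsIIDSeq.measureReal_belowUpTo_le [IsProbabilityMeasure P] (h : IsIIDSeq P X) {δ c : ℝ} {r : ℕ} (hδ : 0 < δ)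
    (hr1 : 1 ≤ r) (hr : c ≤ r * δ) (m : ℕ) :
    P.real {ω | X 0 ω ≤ -δ} ^ r * P.real {ω | BelowUpTo c m fun i => X i ω} ≤
      persistenceProb P X m := by
  let A : Set (ℕ → ℝ) := {x | ∀ i < r, x i ≤ -δ}
  let C : Set (ℕ → ℝ) := {x | BelowUpTo c m x}
  have hA : MeasurableSet A := by
    simp only [A, Set.ofPred_forall]
    exact .iInter fun i => .iInter fun _ => measurableSet_le (measurable_pi_apply i) measurable_const
  have hC : MeasurableSet C := measurableSet_belowUpTo c m
  have hX := h.measurable_seq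
  have hind := h.indepFun_of_dependsOn (S := Finset.range r) (T := Finset.Ico r (r + m))
    (F := A.indicator 1) (G := fun x => C.indicator 1 (shiftSeq r x)) (by
        rw [Finset.disjoint_left]; intro i hi hi'
        simp only [Finset.mem_range, Finset.mem_Ico] at *
        omega) (measurable_one.indicator hA)
    ((measurable_one.indicator hC).comp (measurable_shiftSeq r))
    (fun x y hxy => by
      have : (x ∈ A) = (y ∈ A) := propext (forall₂_congr fun i hi => by rw [hxy i (by simpa)])
      simp only [Set.indicator, this, Pi.one_apply])
    (fun x y hxy => by
      have : (shiftSeq r x ∈ C) = (shiftSeq r y ∈ C) := dependsOn_belowUpTo c m fun i hi =>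
        hxy _ (by simp at *; omega)
      show C.indicator 1 (shiftSeq r x) = C.indicator 1 (shiftSeq r y)
      by_cases hc : shiftSeq r x ∈ C
      · rw [Set.indicator_of_mem hc, Set.indicator_of_mem (this.mp hc)]; rfl
      · rw [Set.indicator_of_notMem hc, Set.indicator_of_notMem fun h => hc (this.mpr h)])
  have h1 := hind.integral_fun_mul_eq_mul_integral
    ((measurable_one.indicator hA).comp hX).aestronglyMeasurable
    (((measurable_one.indicator hC).comp (measurable_shiftSeq r)).comp hX).aestronglyMeasurable
  have h2 : ∫ ω, A.indicator 1 (fun i => X i ω) ∂P = P.real {ω | X 0 ω ≤ -δ} ^ r := by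
    rw [← h.measureReal_initial]
    exact h.integral_indicator_one_comp hA
  have h3 : ∫ ω, C.indicator 1 (shiftSeq r fun i => X i ω) ∂P =
      P.real {ω | BelowUpTo c m fun i => X i ω} := by
    have := ((h.identDistrib_precomp (add_right_injective r)).comp
      (measurable_one.indicator (f := (1 : (ℕ → ℝ) → ℝ)) hC)).integral_eq
    exact this.trans (h.integral_indicator_one_comp hC)
  rw [h2, h3] at h1
  rw [← h1, persistenceProb_eq]
  refine le_of_le_of_eq ?_ (h.integral_indicator_one_comp (measurableSet_negUpTo m))
  refine integral_mono_of_nonneg (ae_of_all _ fun ω => ?_)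
    (h.integrable_indicator_one_comp (measurableSet_negUpTo m)) (ae_of_all _ fun ω => ?_)
  · exact mul_nonneg (Set.indicator_nonneg (by simp) _) (Set.indicator_nonneg (by simp) _)
  · by_cases ha : (fun i => X i ω) ∈ A
    · by_cases hc : shiftSeq r (fun i => X i ω) ∈ C
      · have : (fun i => X i ω) ∈ {x | NegUpTo m x} := negUpTo_of_belowUpTo hδ hr ha hc hr1
        simp [ha, hc, Set.indicator_of_mem this]
      · simp only [hc, Set.indicator_of_notMem, not_false_eq_true, mul_zero]
        exact Set.indicator_nonneg (by simp) _
    · simp only [ha, Set.indicator_of_notMem, not_false_eq_true, zero_mul]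
      exact Set.indicator_nonneg (by simp) _

end IID

/-! ### From convolution inequalities to the persistence exponent -/

lemma sum_Icc_rpow_neg_le {γ : ℝ} (h0 : 0 < γ) (h1 : γ < 1) (M : ℕ) :
    ∑ k ∈ Finset.Icc 1 M, (k : ℝ) ^ (-γ) ≤ (M : ℝ) ^ (1 - γ) / (1 - γ) := by
  have h1' : 0 < 1 - γ := by linarith
  induction M with
  | zero => simp [Real.zero_rpow h1'.ne']
  | succ M ih =>
    rw [Finset.sum_Icc_succ_top (by omega)]
    have hM : (0 : ℝ) < M + 1 := by positivity
    -- Bernoulli's inequality for an exponent below `1` bounds the new term by the increment of `M ^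
    -- (1 - γ) / (1 - γ)`.
    have hb := rpow_one_add_le_one_add_mul_self (s := -1 / ((M : ℝ) + 1)) (p := 1 - γ)
      (by rw [le_div_iff₀ hM]; linarith [Nat.cast_nonneg (α := ℝ) M]) h1'.le (by linarith)
    have h2 : 1 + -1 / ((M : ℝ) + 1) = M / (M + 1) := by field_simp; ring
    rw [h2, Real.div_rpow (by positivity) hM.le] at hb
    have h3 : ((M : ℝ) + 1) ^ (-γ) = (M + 1) ^ (1 - γ) / (M + 1) := by
      rw [show -γ = (1 - γ) - 1 by ring, Real.rpow_sub hM, Real.rpow_one]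
    have hpos : (0 : ℝ) < (M + 1) ^ (1 - γ) := by positivity
    rw [div_le_iff₀ hpos] at hb
    push_cast
    rw [h3]
    calc _ ≤ (M : ℝ) ^ (1 - γ) / (1 - γ) + (M + 1) ^ (1 - γ) / (M + 1) := by linarith
      _ ≤ ((1 + (1 - γ) * (-1 / ((M : ℝ) + 1))) * (M + 1) ^ (1 - γ)) / (1 - γ) +
          (M + 1) ^ (1 - γ) / (M + 1) := by gcongr
      _ = ((M : ℝ) + 1) ^ (1 - γ) / (1 - γ) := by field_simp; ring

section Persistence

variable {Ω : Type*} [MeasurableSpace Ω] {P : Measure Ω} {X : ℕ → Ω → ℝ}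

lemma IsIIDSeq.persistenceProb_le [IsProbabilityMeasure P] (h : IsIIDSeq P X)
    (hi : Integrable (X 0) P) (hneg : 0 < ∫ ω, max (-X 0 ω) 0 ∂P) {b C : ℝ} (hb : 0 < b)
    (hC : ∀ n : ℕ, 1 ≤ n → ∫ ω, |partialSum X n ω| ∂P ≤ C * (n : ℝ) ^ b) :
    ∃ D > 0, ∀ n : ℕ, 1 ≤ n → persistenceProb P X n ≤ D * (n : ℝ) ^ (-((1 - b) / 2)) := by
  set ν := ∫ ω, max (-X 0 ω) 0 ∂P
  have hC0 : 0 ≤ C := by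
    have := hC 1 le_rfl
    simp only [Nat.cast_one, Real.one_rpow, mul_one] at this
    exact le_trans (integral_nonneg fun _ => abs_nonneg _) this
  set E := 8 * C * (3 : ℝ) ^ b / ν with hE
  have hE0 : 0 ≤ E := by positivity
  -- For `n ≤ k ≤ 2 * n` both horizons are below `2 * n`, so by monotonicity each of the `n + 1`
  -- terms is at least `p_{2n} ^ 2 * ν`.
  have key : ∀ n : ℕ, 1 ≤ n → persistenceProb P X (2 * n) ^ 2 ≤ E * (n : ℝ) ^ (b - 1) := by
    intro n hn
    have hn' : (0 : ℝ) < n := by exact_mod_cast hn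
    have h1 := h.sum_persistenceProb_mul_le hi hn
    have h2 : ∑ k ∈ Finset.Icc n (2 * n), persistenceProb P X (2 * n) *
        (persistenceProb P X (2 * n) * ν) ≤ ∑ k ∈ Finset.Icc n (2 * n),
        persistenceProb P X (k - 1) * (persistenceProb P X (3 * n - k - 1) * ν) := by
      refine Finset.sum_le_sum fun k hk => ?_
      rw [Finset.mem_Icc] at hk
      have := persistenceProb_nonneg (P := P) (X := X)
      gcongr
      · exact mul_nonneg (this _) hneg.le
      · exact this _
      · exact persistenceProb_antitone (by omega)
      · exact persistenceProb_antitone (by omega)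
    have h3 : ∑ j ∈ Finset.range (3 * n + 1), ∫ ω, |partialSum X j ω| ∂P ≤
        ∑ j ∈ Finset.range (3 * n + 1), C * (3 * (n : ℝ)) ^ b := by
      refine Finset.sum_le_sum fun j hj => ?_
      rcases Nat.eq_zero_or_pos j with rfl | hj0
      · simp only [partialSum, Finset.range_zero, Finset.sum_empty, abs_zero, integral_zero]
        positivity
      · refine (hC j hj0).trans ?_
        gcongr
        rw [Finset.mem_range] at hj
        exact_mod_cast (by omega : j ≤ 3 * n)
    simp only [Finset.sum_const, Nat.card_Icc, Finset.card_range, nsmul_eq_mul] at h2 h3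
    rw [show 2 * n + 1 - n = n + 1 by omega] at h2
    push_cast at h2 h3
    set p := persistenceProb P X (2 * n)
    have h4 : (n : ℝ) * (p ^ 2 * ν) ≤ 2 / n * ((4 * n) * (C * (3 * (n : ℝ)) ^ b)) := by
      calc (n : ℝ) * (p ^ 2 * ν) ≤ (n + 1) * (p * (p * ν)) := by
            have : 0 ≤ p ^ 2 * ν := by positivity
            nlinarith
        _ ≤ 2 / n * ((3 * n + 1) * (C * (3 * (n : ℝ)) ^ b)) := by
            refine h2.trans (h1.trans ?_)
            gcongr
        _ ≤ _ := by
            gcongr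
            have : (1 : ℝ) ≤ n := by exact_mod_cast hn
            linarith
    rw [Real.mul_rpow (by norm_num) hn'.le] at h4
    rw [Real.rpow_sub hn', Real.rpow_one, hE]
    have h5 : 2 / (n : ℝ) * ((4 * n) * (C * (3 ^ b * (n : ℝ) ^ b))) =
        8 * C * 3 ^ b * (n : ℝ) ^ b := by
      field_simp; ring
    rw [h5] at h4
    rw [div_mul_div_comm, le_div_iff₀ (by positivity)]
    linarith
  have key2 : ∀ n : ℕ, 1 ≤ n →
      persistenceProb P X (2 * n) ≤ √E * (n : ℝ) ^ (-((1 - b) / 2)) := by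
    intro n hn
    have hn' : (0 : ℝ) < n := by exact_mod_cast hn
    refine Real.le_sqrt_of_sq_le (key n hn) |>.trans (le_of_eq ?_)
    rw [Real.sqrt_mul hE0, Real.sqrt_eq_rpow ((n : ℝ) ^ (b - 1)), ← Real.rpow_mul hn'.le]
    congr 2; ring
  by_cases hb1 : b ≤ 1
  swap
  · refine ⟨1, one_pos, fun n hn => ?_⟩
    rw [one_mul]
    refine measureReal_le_one.trans (Real.one_le_rpow (by exact_mod_cast hn) ?_)
    push Not at hb1
    linarith
  -- The `3` comes from `n ≤ 3 * (n / 2)` for `n ≥ 2` with integer division; the added `1` covers `n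
  -- = 1`.
  refine ⟨√E * 3 ^ ((1 - b) / 2) + 1, by positivity, fun n hn => ?_⟩
  have hn' : (0 : ℝ) < n := by exact_mod_cast hn
  rcases Nat.lt_or_ge n 2 with h2 | h2
  · obtain rfl : n = 1 := by omega
    simp only [Nat.cast_one, Real.one_rpow, mul_one]
    have : persistenceProb P X 1 ≤ 1 := measureReal_le_one
    have : 0 ≤ √E * 3 ^ ((1 - b) / 2) := by positivity
    linarith
  · set m := n / 2 with hm
    have hm' : (0 : ℝ) < m := by exact_mod_cast (by omega : 0 < m)
    have hnm : (n : ℝ) ≤ 3 * m := by exact_mod_cast (by omega : n ≤ 3 * m)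
    calc persistenceProb P X n ≤ persistenceProb P X (2 * m) :=
          persistenceProb_antitone (by omega)
      _ ≤ √E * (m : ℝ) ^ (-((1 - b) / 2)) := key2 m (by omega)
      _ ≤ √E * ((n : ℝ) / 3) ^ (-((1 - b) / 2)) := by
          refine mul_le_mul_of_nonneg_left ?_ (by positivity)
          exact Real.rpow_le_rpow_of_nonpos (by positivity) (by linarith) (by linarith)
      _ = √E * 3 ^ ((1 - b) / 2) * (n : ℝ) ^ (-((1 - b) / 2)) := by
          rw [Real.div_rpow hn'.le (by norm_num), Real.rpow_neg (by norm_num : (0 : ℝ) ≤ 3)]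
          field_simp
      _ ≤ _ := by
          have : 0 ≤ (n : ℝ) ^ (-((1 - b) / 2)) := by positivity
          linarith

/-- One of `k` and `2 * m - k` is at least `m`, so one factor of each product is at most `p m`. -/
lemma sum_mul_le_of_antitone {p : ℕ → ℝ} (hp : Antitone p) (h0 : ∀ k, 0 ≤ p k) (m : ℕ) :
    ∑ k ∈ Finset.range (2 * m + 1), p k * p (2 * m - k) ≤
      2 * p m * ∑ k ∈ Finset.range (2 * m + 1), p k := by
  have h1 : ∑ k ∈ Finset.range (2 * m + 1), p (2 * m - k) =
      ∑ k ∈ Finset.range (2 * m + 1), p k := by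
    simpa using Finset.sum_range_reflect p (2 * m + 1)
  calc _ ≤ ∑ k ∈ Finset.range (2 * m + 1), (p m * p k + p m * p (2 * m - k)) := by
        refine Finset.sum_le_sum fun k hk => ?_
        rcases le_total k m with h | h
        · have := mul_le_mul_of_nonneg_left (hp (show m ≤ 2 * m - k by omega)) (h0 k)
          nlinarith [mul_nonneg (h0 m) (h0 (2 * m - k))]
        · have := mul_le_mul_of_nonneg_right (hp h) (h0 (2 * m - k))
          nlinarith [mul_nonneg (h0 m) (h0 k)]
    _ = _ := by rw [Finset.sum_add_distrib, ← Finset.mul_sum, ← Finset.mul_sum, h1]; ring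

/-- The convolution is at least of order `m ^ b` and at most `2 * p m` times a sum that the upper
bound controls by `m ^ (1 - γ)`. Since `b = 1 - 2 * γ`, the quotient has order `m ^ (-γ)`. -/
lemma IsIIDSeq.le_persistenceProb [IsProbabilityMeasure P] (h : IsIIDSeq P X)
    (hi : Integrable (X 0) P) (hX0 : ∫ ω, X 0 ω ∂P = 0) {B δ : ℝ} (hB0 : 0 ≤ B)
    (hB : ∀ᵐ ω ∂P, -B ≤ X 0 ω) (hδ : 0 < δ) (hq : 0 < P.real {ω | X 0 ω ≤ -δ})
    {b c D : ℝ} (hb0 : 0 < b) (hb : b < 1) (hc : 0 < c) (hD : 0 < D)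
    (hc' : ∀ n : ℕ, 1 ≤ n → c * (n : ℝ) ^ b ≤ ∫ ω, |partialSum X n ω| ∂P)
    (hD' : ∀ n : ℕ, 1 ≤ n → persistenceProb P X n ≤ D * (n : ℝ) ^ (-((1 - b) / 2))) :
    ∃ K > 0, ∀ n : ℕ, 1 ≤ n → K * (n : ℝ) ^ (-((1 - b) / 2)) ≤ persistenceProb P X n := by
  set γ := (1 - b) / 2 with hγ
  have hγ0 : 0 < γ := by rw [hγ]; linarith
  have hγ1 : γ < 1 := by rw [hγ]; linarith
  set ν := ∫ ω, max (-X 0 ω) 0 ∂P with hν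
  have hν0 : 0 ≤ ν := integral_nonneg fun _ => le_max_right _ _
  obtain ⟨r, hr⟩ := exists_nat_ge (2 * B / δ)
  have hr' : 2 * B ≤ ((r + 1 : ℕ) : ℝ) * δ := by
    rw [div_le_iff₀ hδ] at hr
    push_cast
    nlinarith
  set q := P.real {ω | X 0 ω ≤ -δ} ^ (r + 1) with hqd
  have hq0 : 0 < q := pow_pos hq _
  have hbel : ∀ m, P.real {ω | BelowUpTo (2 * B) m fun i => X i ω} ≤
      q⁻¹ * persistenceProb P X m := fun m => by
    rw [inv_mul_eq_div, le_div_iff₀ hq0, mul_comm]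
    exact h.measureReal_belowUpTo_le hδ (by omega) hr' m
  have hp0 := persistenceProb_nonneg (P := P) (X := X)
  have hconv : ∀ n : ℕ, 1 ≤ n → c * (n : ℝ) ^ b / 2 ≤
      q⁻¹ ^ 2 * ν * ∑ k ∈ Finset.range n, persistenceProb P X k *
        persistenceProb P X (n - 1 - k) := fun n hn => by
    have h1 := h.integral_abs_partialSum_le hi hX0 hB0 hB hn
    have h2 := hc' n hn
    refine (by linarith : c * (n : ℝ) ^ b / 2 ≤ _).trans (h1.trans ?_)
    rw [Finset.mul_sum, Finset.range_eq_Ico, Finset.sum_Ico_eq_sum_range,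
      show Finset.Icc 1 n = Finset.Ico 1 (n + 1) from rfl, Finset.sum_Ico_eq_sum_range]
    simp only [Nat.add_sub_cancel, Nat.sub_zero]
    refine Finset.sum_le_sum fun k hk => ?_
    rw [← hν, show 1 + k - 1 = 0 + k by omega, show n - (1 + k) = n - 1 - (0 + k) by omega]
    calc _ ≤ (q⁻¹ * persistenceProb P X (0 + k)) *
          ((q⁻¹ * persistenceProb P X (n - 1 - (0 + k))) * ν) := by
          gcongr
          · exact mul_nonneg (inv_nonneg.2 hq0.le) (hp0 _)
          · exact hbel _
          · exact hbel _
      _ = _ := by ring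
  set A := 1 + D * 2 ^ (1 - γ) / (1 - γ) with hA
  have hA0 : 0 < A := by
    have : 0 < 1 - γ := by linarith
    positivity
  have hsum : ∀ m : ℕ, 1 ≤ m → ∑ k ∈ Finset.range (2 * m + 1), persistenceProb P X k ≤
      A * (m : ℝ) ^ (1 - γ) := fun m hm => by
    have hm' : (1 : ℝ) ≤ m := by exact_mod_cast hm
    have h1γ : 0 < 1 - γ := by linarith
    rw [Finset.sum_range_succ']
    have h1 : persistenceProb P X 0 ≤ (m : ℝ) ^ (1 - γ) :=
      le_trans measureReal_le_one (Real.one_le_rpow hm' h1γ.le)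
    have h2 : ∑ k ∈ Finset.range (2 * m), persistenceProb P X (k + 1) ≤
        D * (((2 * m : ℕ) : ℝ) ^ (1 - γ) / (1 - γ)) := by
      refine le_trans ?_ (mul_le_mul_of_nonneg_left (sum_Icc_rpow_neg_le hγ0 hγ1 (2 * m)) hD.le)
      rw [Finset.mul_sum, show Finset.Icc 1 (2 * m) = Finset.Ico 1 (2 * m + 1) from rfl,
        Finset.sum_Ico_eq_sum_range]
      simp only [Nat.add_sub_cancel]
      exact Finset.sum_le_sum fun k _ => by rw [add_comm 1 k]; exact hD' _ (by omega)
    push_cast at h2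
    rw [Real.mul_rpow (by norm_num) (by linarith)] at h2
    rw [hA]
    calc _ ≤ _ := add_le_add h2 h1
      _ = _ := by ring
  have hmain : ∀ m : ℕ, 1 ≤ m → c * (m : ℝ) ^ b / 2 ≤
      q⁻¹ ^ 2 * ν * (2 * persistenceProb P X m * (A * (m : ℝ) ^ (1 - γ))) := fun m hm => by
    calc c * (m : ℝ) ^ b / 2 ≤ c * ((2 * m + 1 : ℕ) : ℝ) ^ b / 2 := by
          gcongr; omega
      _ ≤ _ := hconv (2 * m + 1) (by omega)
      _ ≤ q⁻¹ ^ 2 * ν * (2 * persistenceProb P X m *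
            ∑ k ∈ Finset.range (2 * m + 1), persistenceProb P X k) := by
          refine mul_le_mul_of_nonneg_left ?_ (by positivity)
          exact sum_mul_le_of_antitone persistenceProb_antitone hp0 m
      _ ≤ _ := by
          refine mul_le_mul_of_nonneg_left ?_ (by positivity)
          exact mul_le_mul_of_nonneg_left (hsum m hm) (by linarith [hp0 m])
  -- If `ν` vanished, `hmain` at `m = 1` would give `c / 2 ≤ 0`.
  have hν1 : 0 < ν := by
    rcases hν0.lt_or_eq with h | h
    · exact h
    · have := hmain 1 le_rfl
      rw [← h] at this
      simp only [Nat.cast_one, Real.one_rpow] at this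
      linarith
  refine ⟨c / 2 / (q⁻¹ ^ 2 * ν * 2 * A), by positivity, fun m hm => ?_⟩
  have hm' : (0 : ℝ) < m := by exact_mod_cast hm
  have h1 := hmain m hm
  have h2 : (m : ℝ) ^ b = (m : ℝ) ^ (-γ) * (m : ℝ) ^ (1 - γ) := by
    rw [← Real.rpow_add hm']; congr 1; rw [hγ]; ring
  have h3 : (0 : ℝ) < (m : ℝ) ^ (1 - γ) := by positivity
  rw [h2] at h1
  rw [div_mul_eq_mul_div, div_le_iff₀ (by positivity)]
  refine le_of_mul_le_mul_right ?_ h3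
  calc _ = c * ((m : ℝ) ^ (-γ) * (m : ℝ) ^ (1 - γ)) / 2 := by ring
    _ ≤ _ := h1
    _ = _ := by ring

/-- Persistence exponent for summands bounded below, from the order of `E|S_n|`. -/
theorem IsIIDSeq.sameOrder_persistenceProb [IsProbabilityMeasure P] (h : IsIIDSeq P X)
    (hi : Integrable (X 0) P) (hX0 : ∫ ω, X 0 ω ∂P = 0) {B δ : ℝ} (hB0 : 0 ≤ B)
    (hB : ∀ᵐ ω ∂P, -B ≤ X 0 ω) (hδ : 0 < δ) (hq : 0 < P.real {ω | X 0 ω ≤ -δ})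
    {b : ℝ} (hb0 : 0 < b) (hb : b < 1)
    (hE : SameOrder (fun n => ∫ ω, |partialSum X n ω| ∂P) fun n => (n : ℝ) ^ b) :
    SameOrder (fun n => persistenceProb P X n) fun n => (n : ℝ) ^ (-((1 - b) / 2)) := by
  obtain ⟨C₁, hC₁, C₂, hC₂, hC⟩ := hE
  have hneg : 0 < ∫ ω, max (-X 0 ω) 0 ∂P := by
    have h1 : δ * P.real {ω | X 0 ω ≤ -δ} ≤ ∫ ω, max (-X 0 ω) 0 ∂P := by
      have := mul_meas_ge_le_integral_of_nonneg (μ := P) (f := fun ω => max (-X 0 ω) 0)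
        (ae_of_all _ fun _ => le_max_right _ _) (hi.neg.sup (integrable_zero _ _ _)) δ
      refine le_trans ?_ this
      refine mul_le_mul_of_nonneg_left (measureReal_mono fun ω hω => ?_) hδ.le
      have hω' : X 0 ω ≤ -δ := hω
      show δ ≤ max (-X 0 ω) 0
      exact le_max_of_le_left (by linarith)
    exact lt_of_lt_of_le (mul_pos hδ hq) h1
  obtain ⟨D, hD, hD'⟩ := h.persistenceProb_le hi hneg hb0 (C := C₁⁻¹) fun n hn => by
    rw [inv_mul_eq_div, le_div_iff₀ hC₁, mul_comm]
    exact (hC n hn).1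
  obtain ⟨K, hK, hK'⟩ := h.le_persistenceProb hi hX0 hB0 hB hδ hq hb0 hb (inv_pos.2 hC₂) hD
    (fun n hn => by
      rw [inv_mul_eq_div, div_le_iff₀ hC₂, mul_comm]
      exact (hC n hn).2) hD'
  refine ⟨D⁻¹, inv_pos.2 hD, K⁻¹, inv_pos.2 hK, fun n hn => ⟨?_, ?_⟩⟩
  · rw [inv_mul_eq_div, div_le_iff₀ hD, mul_comm]
    exact hD' n hn
  · rw [inv_mul_eq_div, le_div_iff₀ hK, mul_comm]
    exact hK' n hn

end Persistence

/-! ### Absolute moments through characteristic functions -/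

/-- The power `a` is integrable near `0` and the power `b` near infinity. This minimum is the
dominating function in both limit passages below. -/
lemma integrableOn_min_rpow {a b : ℝ} (ha : -1 < a) (hb : b < -1) :
    IntegrableOn (fun u : ℝ => min (u ^ a) (u ^ b)) (Set.Ioi 0) := by
  have hm : Measurable fun u : ℝ => min (u ^ a) (u ^ b) := by fun_prop
  have hn : ∀ u : ℝ, 0 < u → 0 ≤ min (u ^ a) (u ^ b) := fun u hu =>
    le_min (by positivity) (by positivity)
  rw [← Set.Ioc_union_Ioi_eq_Ioi zero_le_one]
  refine IntegrableOn.union ?_ ?_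
  · have h1 : IntegrableOn (fun u : ℝ => u ^ a) (Set.Ioc 0 1) :=
      (intervalIntegrable_iff_integrableOn_Ioc_of_le zero_le_one).1
        (intervalIntegral.intervalIntegrable_rpow' ha)
    refine Integrable.mono' h1 hm.aestronglyMeasurable ?_
    filter_upwards [ae_restrict_mem measurableSet_Ioc] with u hu
    rw [Real.norm_of_nonneg (hn u hu.1)]
    exact min_le_left _ _
  · refine Integrable.mono' (integrableOn_Ioi_rpow_of_lt hb one_pos) hm.aestronglyMeasurable ?_
    filter_upwards [ae_restrict_mem measurableSet_Ioi] with u hu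
    rw [Real.norm_of_nonneg (hn u (lt_trans one_pos hu))]
    exact min_le_right _ _

lemma integrableOn_Ioi_of_norm_le {E : Type*} [NormedAddCommGroup E] {a b C : ℝ} {g : ℝ → E}
    (ha : -1 < a) (hb : b < -1) (hg : AEStronglyMeasurable g (volume.restrict (Set.Ioi 0)))
    (h1 : ∀ u, 0 < u → ‖g u‖ ≤ C * u ^ a) (h2 : ∀ u, 0 < u → ‖g u‖ ≤ C * u ^ b) :
    IntegrableOn g (Set.Ioi 0) := by
  refine Integrable.mono' ((integrableOn_min_rpow ha hb).const_mul |C|) hg ?_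
  filter_upwards [ae_restrict_mem measurableSet_Ioi] with u hu
  have hu' : (0 : ℝ) < u := hu
  rw [mul_min_of_nonneg _ _ (abs_nonneg C)]
  refine le_min ((h1 u hu).trans ?_) ((h2 u hu).trans ?_)
  · exact mul_le_mul_of_nonneg_right (le_abs_self C) (by positivity)
  · exact mul_le_mul_of_nonneg_right (le_abs_self C) (by positivity)

lemma setIntegral_Ioi_pos {f : ℝ → ℝ} (hf : IntegrableOn f (Set.Ioi 0))
    (h0 : ∀ u, 0 < u → 0 ≤ f u) (h1 : ∀ u, 0 < u → u < 1 → 0 < f u) :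
    0 < ∫ u in Set.Ioi 0, f u := by
  rw [setIntegral_pos_iff_support_of_nonneg_ae _ hf]
  · refine lt_of_lt_of_le ?_ (measure_mono (s := Set.Ioo 0 1) fun u hu =>
      ⟨(h1 u hu.1 hu.2).ne', hu.1⟩)
    simp
  · filter_upwards [ae_restrict_mem measurableSet_Ioi] with u hu using h0 u hu

lemma cos_lt_one_of_pos_of_lt_one {u : ℝ} (h0 : 0 < u) (h1 : u < 1) : Real.cos u < 1 := by
  rw [← Real.cos_zero]
  exact Real.cos_lt_cos_of_nonneg_of_le_pi le_rfl (by linarith [Real.pi_gt_three]) h0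

/-- The integral `∫₀^∞ (1 - cos u) / u² du`. -/
noncomputable def cosKernel : ℝ := ∫ u in Set.Ioi (0 : ℝ), (1 - Real.cos u) / u ^ 2

lemma one_sub_cos_le_sq (u : ℝ) : 1 - Real.cos u ≤ u ^ 2 := by
  have := Real.one_sub_sq_div_two_le_cos (x := u)
  nlinarith [sq_nonneg u]

lemma integrableOn_cosKernel (z : ℝ) :
    IntegrableOn (fun u : ℝ => (1 - Real.cos (z * u)) / u ^ 2) (Set.Ioi 0) := by
  have hn : ∀ u : ℝ, 0 < u →
      ‖(1 - Real.cos (z * u)) / u ^ 2‖ = (1 - Real.cos (z * u)) / u ^ 2 := fun u _ =>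
    Real.norm_of_nonneg (div_nonneg (by linarith [Real.cos_le_one (z * u)]) (sq_nonneg u))
  refine integrableOn_Ioi_of_norm_le (a := 0) (b := -2) (C := z ^ 2 + 2) (by norm_num)
    (by norm_num) (Measurable.aestronglyMeasurable (by fun_prop)) (fun u hu => ?_)
    (fun u hu => ?_)
  · rw [hn u hu, Real.rpow_zero, div_le_iff₀ (by positivity)]
    nlinarith [one_sub_cos_le_sq (z * u), sq_nonneg u]
  · rw [hn u hu, Real.rpow_neg hu.le, Real.rpow_two, ← div_eq_mul_inv]
    gcongr
    nlinarith [Real.neg_one_le_cos (z * u), sq_nonneg z]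

lemma cosKernel_pos : 0 < cosKernel := by
  have h := integrableOn_cosKernel 1
  simp only [one_mul] at h
  exact setIntegral_Ioi_pos h
    (fun u _ => div_nonneg (by linarith [Real.cos_le_one u]) (sq_nonneg u))
    (fun u h0 h1 => div_pos (by linarith [cos_lt_one_of_pos_of_lt_one h0 h1]) (by positivity))

lemma integral_cosKernel (z : ℝ) :
    ∫ u in Set.Ioi (0 : ℝ), (1 - Real.cos (z * u)) / u ^ 2 = |z| * cosKernel := by
  rcases eq_or_ne z 0 with rfl | hz
  · simp
  have hz' : 0 < |z| := abs_pos.2 hz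
  -- Rescaling by `|z|` suffices because the cosine is even.
  have h := integral_comp_mul_left_Ioi (fun u : ℝ => (1 - Real.cos u) / u ^ 2) 0 hz'
  rw [mul_zero, smul_eq_mul] at h
  rw [cosKernel, eq_inv_mul_iff_mul_eq₀ hz'.ne'] at *
  rw [← h, ← integral_const_mul, ← integral_const_mul]
  refine setIntegral_congr_fun measurableSet_Ioi fun u hu => ?_
  have hu' : (0 : ℝ) < u := hu
  have : Real.cos (|z| * u) = Real.cos (z * u) := by
    rw [← Real.cos_abs (z * u), abs_mul, abs_of_pos hu']
  simp only [this]
  field_simp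

/-- The first absolute moment in terms of the characteristic function. -/
lemma integral_abs_mul_cosKernel (μ : Measure ℝ) [IsProbabilityMeasure μ]
    (hμ : Integrable (fun x => x) μ) :
    (∫ x, |x| ∂μ) * cosKernel = ∫ t in Set.Ioi (0 : ℝ), (1 - (charFun μ t).re) / t ^ 2 := by
  -- Fubini: integrating in `t` first produces `|x| * cosKernel`, integrating in `x` first produces
  -- the characteristic function.
  have hprod : Integrable (Function.uncurry fun x t : ℝ => (1 - Real.cos (x * t)) / t ^ 2)
      (μ.prod (volume.restrict (Set.Ioi 0))) := by
    have hm : AEStronglyMeasurable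
        (Function.uncurry fun x t : ℝ => (1 - Real.cos (x * t)) / t ^ 2)
        (μ.prod (volume.restrict (Set.Ioi 0))) := by
      refine Measurable.aestronglyMeasurable ?_
      unfold Function.uncurry
      fun_prop
    rw [integrable_prod_iff hm]
    refine ⟨ae_of_all _ fun x => integrableOn_cosKernel x, ?_⟩
    have : ∀ x : ℝ, ∫ t in Set.Ioi (0 : ℝ),
        ‖Function.uncurry (fun x t : ℝ => (1 - Real.cos (x * t)) / t ^ 2) (x, t)‖ =
        |x| * cosKernel := fun x => by
      rw [← integral_cosKernel]
      refine setIntegral_congr_fun measurableSet_Ioi fun t _ => ?_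
      exact Real.norm_of_nonneg
        (div_nonneg (by linarith [Real.cos_le_one (x * t)]) (sq_nonneg t))
    simp_rw [this]
    exact hμ.abs.mul_const _
  have h := integral_integral_swap hprod
  simp_rw [integral_cosKernel] at h
  rw [integral_mul_const] at h
  rw [h]
  refine integral_congr_ae (ae_of_all _ fun t => ?_)
  have hint : Integrable (fun x : ℝ => Complex.exp (t * x * Complex.I)) μ := by
    refine Integrable.of_bound (C := 1) (by fun_prop) (ae_of_all _ fun x => ?_)
    rw [← Complex.ofReal_mul, Complex.norm_exp_ofReal_mul_I]
  have hre : (charFun μ t).re = ∫ x, Real.cos (x * t) ∂μ := by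
    rw [charFun_apply_real]
    refine (integral_re hint).symm.trans (integral_congr_ae (ae_of_all _ fun x => ?_))
    simp only [RCLike.re_to_complex]
    rw [← Complex.ofReal_mul, Complex.exp_ofReal_mul_I_re, mul_comm]
  simp only
  rw [integral_div, integral_sub (integrable_const _), hre]
  · simp
  · exact Integrable.of_bound (C := 1) (by fun_prop) (ae_of_all _ fun x => Real.abs_cos_le_one _)

/-- The second order remainder of the exponential on the imaginary axis. -/
noncomputable def expRem (x : ℝ) : ℂ := Complex.exp (x * Complex.I) - 1 - x * Complex.I

@[fun_prop]
lemma continuous_expRem : Continuous expRem := by unfold expRem; fun_prop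

lemma norm_expRem_le (x : ℝ) : ‖expRem x‖ ≤ 2 * |x| := by
  have h1 := Real.norm_exp_I_mul_ofReal_sub_one_le (x := x)
  rw [mul_comm] at h1
  refine (norm_sub_le _ _).trans ?_
  rw [norm_mul, Complex.norm_I, mul_one, Complex.norm_real]
  rw [Real.norm_eq_abs] at *
  linarith

lemma norm_expRem_le_sq (x : ℝ) : ‖expRem x‖ ≤ 2 * x ^ 2 := by
  rcases le_total |x| 1 with h | h
  · have := Complex.norm_exp_sub_one_sub_id_le (x := x * Complex.I) (by simpa using h)
    rw [norm_mul, Complex.norm_I, mul_one, Complex.norm_real, Real.norm_eq_abs, sq_abs] at this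
    exact this.trans (by nlinarith [sq_nonneg x])
  · refine (norm_expRem_le x).trans ?_
    rw [← sq_abs]
    nlinarith

lemma re_expRem (x : ℝ) : (expRem x).re = Real.cos x - 1 := by
  simp [expRem, Complex.exp_ofReal_mul_I_re]

/-! ### Characteristic function of the centred Pareto law -/

section Pareto

variable {α : ℝ}

/-- The rescaled remainder of the characteristic function of a Pareto variable centred at `m`. -/
noncomputable def paretoRem (α m t : ℝ) : ℂ :=
  ∫ u in Set.Ioi (0 : ℝ), Set.indicator (Set.Ioi t)
    (fun u => ((α * u ^ (-(α + 1)) : ℝ) : ℂ) * expRem (u - t * m)) u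

/-- On `u > t` one has `|u - t * m| ≤ (1 + m) * u`, so the quadratic and linear bounds on `expRem`
hold uniformly in `t`. For `1 < α < 2` the resulting powers are integrable at `0` and at infinity
respectively. -/
lemma norm_paretoRem_integrand_le (hα : 0 < α) {m t u : ℝ} (hm : 0 ≤ m) (ht : 0 ≤ t)
    (hu : 0 < u) :
    ‖Set.indicator (Set.Ioi t)
      (fun u => ((α * u ^ (-(α + 1)) : ℝ) : ℂ) * expRem (u - t * m)) u‖ ≤
      2 * α * (1 + m) ^ 2 * min (u ^ (1 - α)) (u ^ (-α)) := by
  have hr : 0 ≤ 2 * α * (1 + m) ^ 2 * min (u ^ (1 - α)) (u ^ (-α)) :=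
    mul_nonneg (by positivity) (le_min (by positivity) (by positivity))
  by_cases hut : u ∈ Set.Ioi t
  swap
  · rwa [Set.indicator_of_notMem hut, norm_zero]
  rw [Set.indicator_of_mem hut, norm_mul, Complex.norm_real,
    Real.norm_of_nonneg (by positivity : 0 ≤ α * u ^ (-(α + 1)))]
  have hut' : t < u := hut
  have habs : |u - t * m| ≤ (1 + m) * u := by
    rw [abs_le]
    constructor <;> nlinarith [mul_nonneg ht hm]
  have h1 : ‖expRem (u - t * m)‖ ≤ 2 * (1 + m) ^ 2 * u := by
    refine (norm_expRem_le _).trans ?_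
    nlinarith [mul_nonneg hm hu.le, mul_nonneg (mul_nonneg hm hm) hu.le]
  have h2 : ‖expRem (u - t * m)‖ ≤ 2 * (1 + m) ^ 2 * u ^ 2 := by
    refine (norm_expRem_le_sq _).trans ?_
    rw [← sq_abs]
    have := pow_le_pow_left₀ (abs_nonneg _) habs 2
    nlinarith
  have e1 : u ^ (1 - α) = u ^ (-(α + 1)) * u ^ 2 := by
    rw [← Real.rpow_natCast u 2, ← Real.rpow_add hu]; congr 1; push_cast; ring
  have e2 : u ^ (-α) = u ^ (-(α + 1)) * u := by
    nth_rw 3 [← Real.rpow_one u]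
    rw [← Real.rpow_add hu]; congr 1; ring
  have hp : 0 ≤ α * u ^ (-(α + 1)) := by positivity
  rw [mul_min_of_nonneg _ _ (by positivity), e1, e2]
  refine le_min ?_ ?_
  · exact (mul_le_mul_of_nonneg_left h2 hp).trans (le_of_eq (by ring))
  · exact (mul_le_mul_of_nonneg_left h1 hp).trans (le_of_eq (by ring))

lemma measurable_paretoRem_integrand (m t : ℝ) :
    Measurable (Set.indicator (Set.Ioi t)
      (fun u => ((α * u ^ (-(α + 1)) : ℝ) : ℂ) * expRem (u - t * m))) :=
  Measurable.indicator (by fun_prop) measurableSet_Ioi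

lemma exists_norm_paretoRem_le (h1 : 1 < α) (h2 : α < 2) {m : ℝ} (hm : 0 ≤ m) :
    ∃ K, ∀ t, 0 ≤ t → ‖paretoRem α m t‖ ≤ K := by
  refine ⟨_, fun t ht => norm_integral_le_of_norm_le
    ((integrableOn_min_rpow (a := 1 - α) (b := -α) (by linarith) (by linarith)).const_mul
      (2 * α * (1 + m) ^ 2)) ?_⟩
  filter_upwards [ae_restrict_mem measurableSet_Ioi] with u hu
  exact norm_paretoRem_integrand_le (by linarith) hm ht hu

lemma tendsto_paretoRem (h1 : 1 < α) (h2 : α < 2) {m : ℝ} (hm : 0 ≤ m) {s : ℕ → ℝ}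
    (hs0 : ∀ n, 0 ≤ s n) (hs : Tendsto s atTop (𝓝 0)) :
    Tendsto (fun n => paretoRem α m (s n)) atTop (𝓝 (paretoRem α m 0)) := by
  refine tendsto_integral_of_dominated_convergence _
    (fun n => (measurable_paretoRem_integrand m (s n)).aestronglyMeasurable)
    ((integrableOn_min_rpow (a := 1 - α) (b := -α) (by linarith) (by linarith)).const_mul
      (2 * α * (1 + m) ^ 2)) (fun n => ?_) ?_
  · filter_upwards [ae_restrict_mem measurableSet_Ioi] with u hu
    exact norm_paretoRem_integrand_le (by linarith) hm (hs0 n) hu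
  · filter_upwards [ae_restrict_mem measurableSet_Ioi] with u hu
    have hu' : (0 : ℝ) < u := hu
    rw [Set.indicator_of_mem (show u ∈ Set.Ioi (0 : ℝ) from hu)]
    have h3 : Tendsto (fun n => ((α * u ^ (-(α + 1)) : ℝ) : ℂ) * expRem (u - s n * m)) atTop
        (𝓝 (((α * u ^ (-(α + 1)) : ℝ) : ℂ) * expRem (u - 0 * m))) :=
      ((continuous_expRem.tendsto _).comp
        (tendsto_const_nhds.sub (hs.mul_const m))).const_mul _
    refine h3.congr' ?_
    filter_upwards [hs.eventually_lt_const hu'] with n hn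
    rw [Set.indicator_of_mem (show u ∈ Set.Ioi (s n) from hn)]

/-- The real part is minus the integral of a positive weight against `1 - cos u`. Its sign makes the
limiting exponential decay, and hence the limit of the moments positive. -/
lemma re_paretoRem_zero_neg (h1 : 1 < α) (h2 : α < 2) (m : ℝ) : (paretoRem α m 0).re < 0 := by
  have hint : IntegrableOn (fun u : ℝ => ((α * u ^ (-(α + 1)) : ℝ) : ℂ) * expRem u)
      (Set.Ioi 0) := by
    refine Integrable.mono' ((integrableOn_min_rpow (a := 1 - α) (b := -α) (by linarith)
      (by linarith)).const_mul (2 * α * (1 + 0) ^ 2)) (by fun_prop) ?_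
    filter_upwards [ae_restrict_mem measurableSet_Ioi] with u hu
    have := norm_paretoRem_integrand_le (α := α) (by linarith) le_rfl le_rfl hu
    rw [Set.indicator_of_mem hu] at this
    simpa using this
  have h3 : paretoRem α m 0 =
      ∫ u in Set.Ioi (0 : ℝ), ((α * u ^ (-(α + 1)) : ℝ) : ℂ) * expRem u := by
    refine setIntegral_congr_fun measurableSet_Ioi fun u hu => ?_
    rw [Set.indicator_of_mem hu, zero_mul, sub_zero]
  have h4 : (paretoRem α m 0).re =
      -∫ u in Set.Ioi (0 : ℝ), α * u ^ (-(α + 1)) * (1 - Real.cos u) := by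
    rw [h3, ← integral_neg]
    refine (integral_re hint).symm.trans (integral_congr_ae (ae_of_all _ fun u => ?_))
    simp only [RCLike.re_to_complex]
    rw [Complex.re_ofReal_mul, re_expRem]; ring
  rw [h4, neg_lt_zero]
  refine setIntegral_Ioi_pos ?_ (fun u hu => ?_) (fun u hu hu1 => ?_)
  · have := hint.re.neg
    refine this.congr (ae_of_all _ fun u => ?_)
    simp only [RCLike.re_to_complex, Pi.neg_apply]
    rw [Complex.re_ofReal_mul, re_expRem]; ring
  · have := Real.cos_le_one u
    have hα : 0 < α := by linarith
    have : 0 ≤ 1 - Real.cos u := by linarith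
    positivity
  · have := cos_lt_one_of_pos_of_lt_one hu hu1
    have hα : 0 < α := by linarith
    have : 0 < 1 - Real.cos u := by linarith
    positivity

lemma integrable_paretoMeasure_iff (hα : 0 < α) {E : Type*} [NormedAddCommGroup E]
    [NormedSpace ℝ E] (f : ℝ → E) :
    Integrable f (paretoMeasure 1 α) ↔
      IntegrableOn (fun y => (α * y ^ (-(α + 1))) • f y) (Set.Ioi 1) := by
  rw [paretoMeasure, integrable_withDensity_iff_integrable_smul'
    (by unfold paretoPDF; fun_prop) (ae_of_all _ fun x => by simp [paretoPDF]),
    ← integrableOn_Ici_iff_integrableOn_Ioi, ← integrable_indicator_iff measurableSet_Ici]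
  refine integrable_congr (ae_of_all _ fun y => ?_)
  simp only [paretoPDF]
  rw [ENNReal.toReal_ofReal (paretoPDFReal_nonneg zero_le_one hα.le y), paretoPDFReal]
  by_cases hy : (1 : ℝ) ≤ y
  · rw [Set.indicator_of_mem (show y ∈ Set.Ici (1 : ℝ) from hy), if_pos hy, Real.one_rpow, mul_one]
  · rw [Set.indicator_of_notMem (show y ∉ Set.Ici (1 : ℝ) from hy), if_neg hy, zero_smul]

lemma integral_paretoMeasure (hα : 0 < α) {E : Type*} [NormedAddCommGroup E]
    [NormedSpace ℝ E] (f : ℝ → E) :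
    ∫ y, f y ∂(paretoMeasure 1 α) = ∫ y in Set.Ioi (1 : ℝ), (α * y ^ (-(α + 1))) • f y := by
  rw [paretoMeasure, integral_withDensity_eq_integral_toReal_smul
    (by unfold paretoPDF; fun_prop) (ae_of_all _ fun x => by simp [paretoPDF]),
    ← integral_Ici_eq_integral_Ioi, ← integral_indicator measurableSet_Ici]
  refine integral_congr_ae (ae_of_all _ fun y => ?_)
  simp only [paretoPDF]
  rw [ENNReal.toReal_ofReal (paretoPDFReal_nonneg zero_le_one hα.le y), paretoPDFReal]
  by_cases hy : (1 : ℝ) ≤ y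
  · rw [Set.indicator_of_mem (show y ∈ Set.Ici (1 : ℝ) from hy), if_pos hy, Real.one_rpow, mul_one]
  · rw [Set.indicator_of_notMem (show y ∉ Set.Ici (1 : ℝ) from hy), if_neg hy, zero_smul]

lemma integrable_id_paretoMeasure (h1 : 1 < α) :
    Integrable (fun y => y) (paretoMeasure 1 α) := by
  rw [integrable_paretoMeasure_iff (by linarith)]
  refine ((integrableOn_Ioi_rpow_of_lt (a := -α) (by linarith) one_pos).const_mul α).congr ?_
  filter_upwards [ae_restrict_mem measurableSet_Ioi] with y hy
  have hy' : (0 : ℝ) < y := lt_trans one_pos hy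
  rw [smul_eq_mul, mul_assoc]
  congr 1
  nth_rw 3 [← Real.rpow_one y]
  rw [← Real.rpow_add hy']; congr 1; ring

lemma paretoMeasure_real_Ioi (hα : 0 < α) {y : ℝ} (hy : 1 ≤ y) :
    (paretoMeasure 1 α).real (Set.Ioi y) = y ^ (-α) := by
  have := isProbabilityMeasure_paretoMeasure (t := 1) one_pos hα
  have hy0 : 0 < y := by linarith
  rw [← integral_indicator_one measurableSet_Ioi, integral_paretoMeasure hα]
  have h1 : ∀ u : ℝ, (α * u ^ (-(α + 1))) • (Set.Ioi y).indicator (1 : ℝ → ℝ) u =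
      (Set.Ioi y).indicator (fun u => α * u ^ (-(α + 1))) u := fun u => by
    by_cases hu : u ∈ Set.Ioi y
    · simp [hu]
    · simp only [Set.indicator_of_notMem hu, smul_zero]
  simp_rw [h1]
  rw [setIntegral_indicator measurableSet_Ioi,
    Set.inter_eq_right.2 (Set.Ioi_subset_Ioi hy), integral_const_mul,
    integral_Ioi_rpow_of_lt (by linarith) hy0]
  rw [show -(α + 1) + 1 = -α by ring]
  field_simp

lemma eq_paretoMeasure (hα : 0 < α) (μ : Measure ℝ) [IsProbabilityMeasure μ]
    (h : ∀ y : ℝ, 1 ≤ y → μ.real (Set.Ioi y) = y ^ (-α)) : μ = paretoMeasure 1 α := by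
  have := isProbabilityMeasure_paretoMeasure (t := 1) one_pos hα
  have key : ∀ ν : Measure ℝ, IsProbabilityMeasure ν →
      (∀ y : ℝ, 1 ≤ y → ν.real (Set.Ioi y) = y ^ (-α)) →
      ∀ y : ℝ, ν.real (Set.Ioi y) = (max y 1) ^ (-α) := fun ν _ hν y => by
    -- The tail at `1` already equals `1`, so there is no mass at or below `1` and the tail is known
    -- everywhere.
    rcases le_total 1 y with hy | hy
    · rw [hν y hy, max_eq_left hy]
    · rw [max_eq_right hy, Real.one_rpow]
      refine le_antisymm measureReal_le_one ?_
      have := hν 1 le_rfl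
      rw [Real.one_rpow] at this
      rw [← this]
      exact measureReal_mono (Set.Ioi_subset_Ioi hy)
  refine Measure.ext_of_Iic _ _ fun a => ?_
  rw [← measureReal_eq_measureReal_iff, ← Set.compl_Ioi, probReal_compl_eq_one_sub measurableSet_Ioi,
    probReal_compl_eq_one_sub measurableSet_Ioi, key μ inferInstance h,
    key _ inferInstance fun y hy => paretoMeasure_real_Ioi hα hy]

/-- Expansion at `0` of the characteristic function of a centred Pareto variable. -/
lemma charFun_pareto_centered (h1 : 1 < α) {m t : ℝ}
    (hm : m = ∫ y, y ∂(paretoMeasure 1 α)) (ht : 0 < t) :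
    ∫ y, Complex.exp (t * (y - m) * Complex.I) ∂(paretoMeasure 1 α) =
      1 + ((t ^ α : ℝ) : ℂ) * paretoRem α m t := by
  have hα : 0 < α := by linarith
  have := isProbabilityMeasure_paretoMeasure (t := 1) one_pos hα
  have hid := integrable_id_paretoMeasure h1
  have hlin : Integrable (fun y : ℝ => (((t * (y - m) : ℝ) : ℂ)) * Complex.I)
      (paretoMeasure 1 α) :=
    (((hid.sub (integrable_const m)).const_mul t).ofReal).mul_const _
  have hexp : Integrable (fun y : ℝ => Complex.exp (((t * (y - m) : ℝ) : ℂ) * Complex.I))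
      (paretoMeasure 1 α) := by
    refine Integrable.of_bound (C := 1) (by fun_prop) (ae_of_all _ fun y => ?_)
    rw [Complex.norm_exp_ofReal_mul_I]
  have h0 : ∫ y : ℝ, (((t * (y - m) : ℝ) : ℂ)) * Complex.I ∂(paretoMeasure 1 α) = 0 := by
    rw [integral_mul_const, integral_complex_ofReal, integral_const_mul,
      integral_sub hid (integrable_const m), ← hm]
    simp
  have h3 : ∫ y, expRem (t * (y - m)) ∂(paretoMeasure 1 α) =
      (∫ y, Complex.exp (t * (y - m) * Complex.I) ∂(paretoMeasure 1 α)) - 1 := by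
    unfold expRem
    rw [integral_sub (f := fun y : ℝ => Complex.exp (((t * (y - m) : ℝ) : ℂ) * Complex.I) - 1)
      (hexp.sub (integrable_const _)) hlin, h0, integral_sub hexp (integrable_const _)]
    simp
  have h4 : ∫ y, expRem (t * (y - m)) ∂(paretoMeasure 1 α) =
      ((t ^ α : ℝ) : ℂ) * paretoRem α m t := by
    rw [integral_paretoMeasure hα]
    -- Substitution `u = t * y`; the factor `t ^ (α + 1)` compensates the scaled density, and the
    -- Jacobian leaves `t ^ α`.
    have h5 := integral_comp_mul_left_Ioi
      (fun u : ℝ => ((t ^ (α + 1) : ℝ) : ℂ) *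
        (((α * u ^ (-(α + 1)) : ℝ) : ℂ) * expRem (u - t * m))) 1 ht
    rw [mul_one] at h5
    have h6 : paretoRem α m t =
        ∫ u in Set.Ioi t, ((α * u ^ (-(α + 1)) : ℝ) : ℂ) * expRem (u - t * m) := by
      rw [paretoRem, setIntegral_indicator measurableSet_Ioi,
        Set.inter_eq_right.2 (Set.Ioi_subset_Ioi ht.le)]
    rw [integral_const_mul (f := fun u : ℝ =>
      ((α * u ^ (-(α + 1)) : ℝ) : ℂ) * expRem (u - t * m)) (μ := volume.restrict (Set.Ioi t)),
      ← h6] at h5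
    have h7 : t⁻¹ • (((t ^ (α + 1) : ℝ) : ℂ) * paretoRem α m t) =
        ((t ^ α : ℝ) : ℂ) * paretoRem α m t := by
      rw [Real.rpow_add ht, Real.rpow_one, Complex.real_smul, ← mul_assoc, ← Complex.ofReal_mul]
      congr 2
      field_simp
    rw [← h7, ← h5]
    refine setIntegral_congr_fun measurableSet_Ioi fun y hy => ?_
    have hy' : (0 : ℝ) < y := lt_trans one_pos hy
    rw [Complex.real_smul, ← mul_assoc, ← Complex.ofReal_mul, Real.mul_rpow ht.le hy'.le,
      Real.rpow_neg ht.le, mul_sub]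
    congr 2
    have : t ^ (α + 1) ≠ 0 := by positivity
    field_simp
  rw [← h4, h3]; ring

end Pareto

/-! ### Limit of the normalized absolute moments -/

lemma norm_one_sub_pow_le {z : ℂ} (hz : ‖z‖ ≤ 1) (n : ℕ) : ‖1 - z ^ n‖ ≤ n * ‖1 - z‖ := by
  induction n with
  | zero => simp
  | succ n ih =>
    have h1 : ‖z ^ n * (1 - z)‖ ≤ ‖1 - z‖ := by
      rw [norm_mul, norm_pow]
      exact mul_le_of_le_one_left (norm_nonneg _) (pow_le_one₀ (norm_nonneg _) hz)
    calc ‖1 - z ^ (n + 1)‖ = ‖(1 - z ^ n) + z ^ n * (1 - z)‖ := by congr 1; ring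
      _ ≤ n * ‖1 - z‖ + ‖1 - z‖ := (norm_add_le _ _).trans (add_le_add ih h1)
      _ = _ := by push_cast; ring

lemma integral_one_sub_re_exp_pos {α : ℝ} (h1 : 1 < α) {c : ℂ} (hc : c.re < 0) :
    0 < ∫ t in Set.Ioi (0 : ℝ), (1 - (Complex.exp (((t ^ α : ℝ) : ℂ) * c)).re) / t ^ 2 := by
  have hnorm : ∀ t : ℝ, 0 < t → ‖Complex.exp (((t ^ α : ℝ) : ℂ) * c)‖ < 1 := fun t ht => by
    rw [Complex.norm_exp, Complex.re_ofReal_mul, Real.exp_lt_one_iff]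
    exact mul_neg_of_pos_of_neg (by positivity) hc
  have hpos : ∀ t : ℝ, 0 < t → 0 < (1 - (Complex.exp (((t ^ α : ℝ) : ℂ) * c)).re) / t ^ 2 :=
    fun t ht => div_pos (sub_pos.2 ((Complex.re_le_norm _).trans_lt (hnorm t ht)))
      (by positivity)
  refine setIntegral_Ioi_pos ?_ (fun t ht => (hpos t ht).le) fun t ht _ => hpos t ht
  refine integrableOn_Ioi_of_norm_le (a := α - 2) (b := -2) (C := 2 * ‖c‖ + 2) (by linarith)
    (by norm_num) (Measurable.aestronglyMeasurable (by fun_prop)) (fun t ht => ?_) (fun t ht => ?_)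
  · rw [Real.norm_of_nonneg (hpos t ht).le, Real.rpow_sub ht, Real.rpow_two, ← mul_div_assoc]
    gcongr
    -- The linear bound on the exponential needs a small argument; otherwise the numerator is at
    -- most `2 ≤ 2 * ‖c‖ * t ^ α`.
    rcases le_total ‖((t ^ α : ℝ) : ℂ) * c‖ 1 with h | h
    · have h3 := Complex.norm_exp_sub_one_le h
      have h4 := Complex.re_le_norm (1 - Complex.exp (((t ^ α : ℝ) : ℂ) * c))
      rw [norm_sub_rev, Complex.sub_re, Complex.one_re] at h4
      rw [norm_mul, Complex.norm_real, Real.norm_of_nonneg (by positivity)] at h3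
      have : 0 < t ^ α := by positivity
      nlinarith
    · have h4 := (Complex.abs_re_le_norm (Complex.exp (((t ^ α : ℝ) : ℂ) * c))).trans
        (hnorm t ht).le
      rw [norm_mul, Complex.norm_real, Real.norm_of_nonneg (by positivity)] at h
      have : 0 < t ^ α := by positivity
      nlinarith [(abs_le.1 h4).1]
  · rw [Real.norm_of_nonneg (hpos t ht).le, Real.rpow_neg ht.le, Real.rpow_two, ← div_eq_mul_inv]
    gcongr
    have h4 := (Complex.abs_re_le_norm (Complex.exp (((t ^ α : ℝ) : ℂ) * c))).trans
        (hnorm t ht).le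
    linarith [(abs_le.1 h4).1, norm_nonneg c]

section AbsMoment

variable {Ω : Type*} [MeasurableSpace Ω] {P : Measure Ω} {X : ℕ → Ω → ℝ}

lemma IsIIDSeq.charFun_partialSum [IsProbabilityMeasure P] (h : IsIIDSeq P X) (n : ℕ) (t : ℝ) :
    charFun (P.map (partialSum X n)) t = charFun (P.map (X 0)) t ^ n := by
  have h1 := iIndepFun.charFun_map_fun_finsetSum_eq_prod (P := P) (X := X) (s := Finset.range n)
    (fun i _ => (h.measurable i).aemeasurable) (h.indep.restrict _)
  have h2 : partialSum X n = fun ω => ∑ i ∈ Finset.range n, X i ω := rfl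
  rw [h2, h1, Finset.prod_apply]
  simp [fun i => (h.identDistrib i).map_eq]

lemma IsIIDSeq.measurable_partialSum (h : IsIIDSeq P X) (n : ℕ) : Measurable (partialSum X n) :=
  Finset.measurable_fun_sum _ fun i _ => h.measurable i

/-- Convergence of the normalized first absolute moments of the partial sums. -/
lemma IsIIDSeq.tendsto_integral_abs_partialSum [IsProbabilityMeasure P] (h : IsIIDSeq P X)
    (hi : Integrable (X 0) P) {α m : ℝ} (h1 : 1 < α) (h2 : α < 2) (hm : 0 ≤ m)
    (hφ : ∀ t : ℝ, 0 < t →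
      charFun (P.map (X 0)) t = 1 + ((t ^ α : ℝ) : ℂ) * paretoRem α m t) :
    Tendsto (fun n : ℕ => (n : ℝ) ^ (-(1 / α)) * ∫ ω, |partialSum X n ω| ∂P) atTop
      (𝓝 ((∫ t in Set.Ioi (0 : ℝ),
        (1 - (Complex.exp (((t ^ α : ℝ) : ℂ) * paretoRem α m 0)).re) / t ^ 2) / cosKernel)) := by
  have hα : 0 < α := by linarith
  set s : ℕ → ℝ := fun n => (n : ℝ) ^ (-(1 / α)) with hs
  have hs0 : ∀ n, 0 ≤ s n := fun n => by positivity
  have hst : Tendsto s atTop (𝓝 0) :=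
    (tendsto_rpow_neg_atTop (by positivity)).comp tendsto_natCast_atTop_atTop
  have hspos : ∀ n, 1 ≤ n → 0 < s n := fun n hn =>
    Real.rpow_pos_of_pos (by exact_mod_cast hn) _
  have hsα : ∀ n : ℕ, 1 ≤ n → ∀ t : ℝ, 0 < t → (s n * t) ^ α = t ^ α / n := fun n hn t ht => by
    rw [Real.mul_rpow (hs0 n) ht.le, hs]
    simp only
    rw [← Real.rpow_mul (by positivity), show -(1 / α) * α = -1 by field_simp, Real.rpow_neg_one]
    ring
  set φ := charFun (P.map (X 0)) with hφd
  have := Measure.isProbabilityMeasure_map (μ := P) (h.measurable 0).aemeasurable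
  have hφ1 : ∀ t, ‖φ t‖ ≤ 1 := norm_charFun_le_one
  have hform : ∀ n : ℕ, s n * ∫ ω, |partialSum X n ω| ∂P =
      (∫ t in Set.Ioi (0 : ℝ), (1 - (φ (s n * t) ^ n).re) / t ^ 2) / cosKernel := fun n => by
    have hmz : Measurable fun ω => s n * partialSum X n ω :=
      (h.measurable_partialSum n).const_mul _
    have := Measure.isProbabilityMeasure_map (μ := P) hmz.aemeasurable
    have h3 := integral_abs_mul_cosKernel (P.map fun ω => s n * partialSum X n ω)
      ((integrable_map_measure (by fun_prop) hmz.aemeasurable).2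
        ((h.integrable_partialSum hi n).const_mul _))
    rw [integral_map hmz.aemeasurable (by fun_prop)] at h3
    simp_rw [abs_mul, abs_of_nonneg (hs0 n)] at h3
    rw [integral_const_mul] at h3
    rw [eq_div_iff cosKernel_pos.ne', h3]
    refine integral_congr_ae (ae_of_all _ fun t => ?_)
    beta_reduce
    rw [charFun_map_mul_comp (h.measurable_partialSum n).aemeasurable, h.charFun_partialSum]
  refine Tendsto.congr (fun n => (hform n).symm) (Tendsto.div_const ?_ _)
  obtain ⟨K, hK⟩ := exists_norm_paretoRem_le h1 h2 hm
  have hK0 : 0 ≤ K := (norm_nonneg _).trans (hK 0 le_rfl)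
  have hmeasφ : Measurable φ := measurable_charFun
  refine tendsto_integral_of_dominated_convergence
    (fun t => (K + 2) * min (t ^ (α - 2)) (t ^ (-2 : ℝ))) (fun n => ?_)
    ((integrableOn_min_rpow (by linarith) (by norm_num)).const_mul _) (fun n => ?_) ?_
  · refine Measurable.aestronglyMeasurable ?_
    have : Measurable fun t : ℝ => (φ (s n * t) ^ n).re :=
      Complex.measurable_re.comp ((hmeasφ.comp (measurable_id.const_mul (s n))).pow_const n)
    fun_prop
  · filter_upwards [ae_restrict_mem measurableSet_Ioi] with t ht
    have ht' : (0 : ℝ) < t := ht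
    have hA : |1 - (φ (s n * t) ^ n).re| ≤ ‖1 - φ (s n * t) ^ n‖ := by
      simpa using Complex.abs_re_le_norm (1 - φ (s n * t) ^ n)
    have hB : ‖1 - φ (s n * t) ^ n‖ ≤ 2 := by
      refine (norm_sub_le _ _).trans ?_
      rw [norm_one, norm_pow]
      linarith [pow_le_one₀ (norm_nonneg _) (hφ1 (s n * t)) (n := n)]
    -- The factor `n` from the power cancels the `1 / n` in `(s n * t) ^ α`, which makes the bound
    -- uniform in `n`.
    have hC : ‖1 - φ (s n * t) ^ n‖ ≤ K * t ^ α := by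
      rcases Nat.eq_zero_or_pos n with rfl | hn
      · simp only [pow_zero, sub_self, norm_zero]; positivity
      · have hst' : 0 < s n * t := mul_pos (hspos n hn) ht'
        have hn' : (0 : ℝ) < n := by exact_mod_cast hn
        refine (norm_one_sub_pow_le (hφ1 _) n).trans ?_
        rw [hφ _ hst', sub_add_cancel_left, norm_neg, norm_mul, Complex.norm_real,
          Real.norm_of_nonneg (by positivity), hsα n hn t ht']
        calc (n : ℝ) * (t ^ α / n * ‖paretoRem α m (s n * t)‖)
            = t ^ α * ‖paretoRem α m (s n * t)‖ := by field_simp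
          _ ≤ t ^ α * K := by gcongr; exact hK _ hst'.le
          _ = _ := mul_comm _ _
    rw [norm_div, Real.norm_eq_abs, Real.norm_of_nonneg (sq_nonneg t),
      mul_min_of_nonneg _ _ (by positivity)]
    refine le_min ?_ ?_
    · rw [Real.rpow_sub ht', Real.rpow_two, ← mul_div_assoc]
      gcongr
      have : 0 < t ^ α := by positivity
      nlinarith
    · rw [Real.rpow_neg ht'.le, Real.rpow_two, ← div_eq_mul_inv]
      gcongr
      linarith
  · filter_upwards [ae_restrict_mem measurableSet_Ioi] with t ht
    have ht' : (0 : ℝ) < t := ht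
    have hrem : Tendsto (fun n => paretoRem α m (s n * t)) atTop (𝓝 (paretoRem α m 0)) :=
      tendsto_paretoRem h1 h2 hm (fun n => mul_nonneg (hs0 n) ht'.le)
        (by simpa using hst.mul_const t)
    -- This is the hypothesis for `(1 + g / n) ^ n → exp`: the powers of `φ` converge to `exp (t ^ α
    -- * paretoRem α m 0)`.
    have hg : Tendsto (fun n : ℕ => (n : ℂ) * (φ (s n * t) - 1)) atTop
        (𝓝 (((t ^ α : ℝ) : ℂ) * paretoRem α m 0)) := by
      refine (hrem.const_mul _).congr' ?_
      filter_upwards [eventually_ge_atTop 1] with n hn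
      have hn' : (n : ℂ) ≠ 0 := by exact_mod_cast (by omega : n ≠ 0)
      rw [hφ _ (mul_pos (hspos n hn) ht'), hsα n hn t ht']
      push_cast
      field_simp
      ring
    have hlim := Complex.tendsto_one_add_pow_exp_of_tendsto hg
    simp only [add_sub_cancel] at hlim
    exact (((Complex.continuous_re.tendsto _).comp hlim).const_sub 1).div_const _

/-- With positive probability all `n` summands are at most `-δ`, which forces `|S_n| ≥ n * δ`. -/
lemma IsIIDSeq.integral_abs_partialSum_pos [IsProbabilityMeasure P] (h : IsIIDSeq P X)
    (hi : Integrable (X 0) P) {δ : ℝ} (hδ : 0 < δ) (hq : 0 < P.real {ω | X 0 ω ≤ -δ}) {n : ℕ}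
    (hn : 1 ≤ n) : 0 < ∫ ω, |partialSum X n ω| ∂P := by
  have hn' : (0 : ℝ) < n := by exact_mod_cast hn
  have h1 := mul_meas_ge_le_integral_of_nonneg (μ := P) (f := fun ω => |partialSum X n ω|)
    (ae_of_all _ fun _ => abs_nonneg _) (h.integrable_partialSum hi n).abs (n * δ)
  refine lt_of_lt_of_le (mul_pos (mul_pos hn' hδ) ?_) h1
  refine lt_of_lt_of_le (pow_pos hq n) ?_
  rw [← h.measureReal_initial]
  refine measureReal_mono fun ω hω => ?_
  have h2 : partialSum X n ω ≤ ∑ i ∈ Finset.range n, -δ :=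
    Finset.sum_le_sum fun i hi => hω i (Finset.mem_range.1 hi)
  simp only [Finset.sum_const, Finset.card_range, nsmul_eq_mul] at h2
  show n * δ ≤ |partialSum X n ω|
  linarith [neg_le_abs (partialSum X n ω)]

end AbsMoment

/-! ### Two-sided bounds and the Pareto example -/

/-- The normalized sequence and its inverse both converge, hence are bounded. Positivity of every
term extends the comparison from large `n` to all `n ≥ 1`. -/
lemma sameOrder_of_tendsto {a : ℕ → ℝ} {b L : ℝ} (hL : 0 < L) (ha : ∀ n, 1 ≤ n → 0 < a n)
    (h : Tendsto (fun n : ℕ => (n : ℝ) ^ (-b) * a n) atTop (𝓝 L)) :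
    SameOrder a fun n => (n : ℝ) ^ b := by
  obtain ⟨M, hM⟩ := h.bddAbove_range
  obtain ⟨M', hM'⟩ := (h.inv₀ hL.ne').bddAbove_range
  have hM1 : ∀ n : ℕ, (n : ℝ) ^ (-b) * a n ≤ M := fun n => hM ⟨n, rfl⟩
  have hM1' : ∀ n : ℕ, ((n : ℝ) ^ (-b) * a n)⁻¹ ≤ M' := fun n => hM' ⟨n, rfl⟩
  have hpos : ∀ n : ℕ, 1 ≤ n → 0 < (n : ℝ) ^ (-b) * a n := fun n hn =>
    mul_pos (Real.rpow_pos_of_pos (by exact_mod_cast hn) _) (ha n hn)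
  have hMp : 0 < M := (hpos 1 le_rfl).trans_le (hM1 1)
  have hMp' : 0 < M' := (inv_pos.2 (hpos 1 le_rfl)).trans_le (hM1' 1)
  refine ⟨M⁻¹, inv_pos.2 hMp, M', hMp', fun n hn => ?_⟩
  have hn' : (0 : ℝ) < n := by exact_mod_cast hn
  have hnb : (0 : ℝ) < (n : ℝ) ^ b := by positivity
  have h1 := hM1 n
  have h2 := hM1' n
  rw [Real.rpow_neg hn'.le, inv_mul_eq_div] at h1 h2
  constructor
  · rw [inv_mul_eq_div, div_le_iff₀ hMp, mul_comm]
    rwa [div_le_iff₀ hnb] at h1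
  · rwa [inv_div, div_le_iff₀ (ha n hn)] at h2

lemma one_lt_integral_paretoMeasure {α : ℝ} (h1 : 1 < α) :
    1 < ∫ y, y ∂(paretoMeasure 1 α) := by
  have h2 : ∫ y, y ∂(paretoMeasure 1 α) = α / (α - 1) := by
    rw [integral_paretoMeasure (by linarith)]
    have : ∀ y ∈ Set.Ioi (1 : ℝ), (α * y ^ (-(α + 1))) • y = α * y ^ (-α) := fun y hy => by
      have hy' : (0 : ℝ) < y := lt_trans one_pos hy
      rw [smul_eq_mul, mul_assoc]
      congr 1
      nth_rw 2 [← Real.rpow_one y]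
      rw [← Real.rpow_add hy']; congr 1; ring
    rw [setIntegral_congr_fun measurableSet_Ioi this, integral_const_mul,
      integral_Ioi_rpow_of_lt (by linarith) one_pos, Real.one_rpow]
    have h3 : α - 1 ≠ 0 := by linarith
    have h4 : -α + 1 ≠ 0 := by intro h; apply h3; linarith
    field_simp
    ring
  rw [h2, one_lt_div (by linarith)]
  linarith

/-- Absolute moments and persistence probabilities for centred Pareto variables. -/
theorem persistence_pareto {α : ℝ} (h1 : 1 < α) (h2 : α < 2) {Ω : Type*} [MeasurableSpace Ω]
    {P : Measure Ω} [IsProbabilityMeasure P] {Y : ℕ → Ω → ℝ} (h : IsIIDSeq P Y)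
    (hY : ∀ y : ℝ, 1 ≤ y → P.real {ω | y < Y 0 ω} = y ^ (-α)) {X : ℕ → Ω → ℝ}
    (hX : ∀ i ω, X i ω = Y i ω - ∫ ω', Y 0 ω' ∂P) :
    IsIIDSeq P X ∧ Integrable (Y 0) P ∧ Integrable (X 0) P ∧ ∫ ω, X 0 ω ∂P = 0 ∧
      (∃ L : ℝ, 0 < L ∧
        Tendsto (fun n : ℕ => (n : ℝ) ^ (-(1 / α)) * ∫ ω, |partialSum X n ω| ∂P)
          atTop (𝓝 L)) ∧
      SameOrder (fun n => ∫ ω, |partialSum X n ω| ∂P) (fun n => (n : ℝ) ^ (1 / α)) ∧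
      SameOrder (fun n => persistenceProb P X n)
        (fun n => (n : ℝ) ^ (-((1 - 1 / α) / 2))) := by
  have hα : 0 < α := by linarith
  have hY0 := h.measurable 0
  have := Measure.isProbabilityMeasure_map (μ := P) hY0.aemeasurable
  have hlaw : P.map (Y 0) = paretoMeasure 1 α := eq_paretoMeasure hα _ fun y hy => by
    rw [map_measureReal_apply hY0 measurableSet_Ioi]
    exact hY y hy
  have hYi : Integrable (Y 0) P := by
    have := integrable_id_paretoMeasure h1
    rw [← hlaw] at this
    exact (integrable_map_measure (by fun_prop) hY0.aemeasurable).1 this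
  set m := ∫ ω, Y 0 ω ∂P with hm
  have hm' : m = ∫ y, y ∂(paretoMeasure 1 α) := by
    rw [← hlaw, integral_map hY0.aemeasurable (by fun_prop)]
  have hm1 : 1 < m := hm' ▸ one_lt_integral_paretoMeasure h1
  have hXc : ∀ i, X i = (fun y => y - m) ∘ Y i := fun i => funext fun ω => hX i ω
  have hsub : Measurable fun y : ℝ => y - m := by fun_prop
  have hiid : IsIIDSeq P X := by
    obtain rfl : X = fun i => (fun y => y - m) ∘ Y i := funext hXc
    exact ⟨fun i => hsub.comp (h.measurable i), h.indep.comp _ fun _ => hsub,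
      fun i => (h.identDistrib i).comp hsub⟩
  have hX0 : X 0 = fun ω => Y 0 ω - m := hXc 0
  have hXi : Integrable (X 0) P := hX0 ▸ hYi.sub (integrable_const m)
  have hXz : ∫ ω, X 0 ω ∂P = 0 := by
    rw [hX0, integral_sub hYi (integrable_const m), ← hm]
    simp
  have hφ : ∀ t : ℝ, 0 < t →
      charFun (P.map (X 0)) t = 1 + ((t ^ α : ℝ) : ℂ) * paretoRem α m t := fun t ht => by
    rw [← charFun_pareto_centered h1 hm' ht, charFun_apply_real,
      integral_map (hiid.measurable 0).aemeasurable (by fun_prop), ← hlaw,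
      integral_map hY0.aemeasurable (by fun_prop), hX0]
    push_cast
    rfl
  have hlim := hiid.tendsto_integral_abs_partialSum hXi h1 h2 (by linarith) hφ
  have hL := div_pos (integral_one_sub_re_exp_pos h1 (re_paretoRem_zero_neg h1 h2 m))
    cosKernel_pos
  -- Any level strictly between `1` and the mean would do; with the midpoint, `X 0 ≤ -δ` means `Y 0
  -- ≤ (m + 1) / 2`, which has positive probability.
  have hδ : 0 < (m - 1) / 2 := by linarith
  have hq : 0 < P.real {ω | X 0 ω ≤ -((m - 1) / 2)} := by
    have h3 : {ω | X 0 ω ≤ -((m - 1) / 2)} = {ω | (m + 1) / 2 < Y 0 ω}ᶜ := by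
      ext ω
      show X 0 ω ≤ _ ↔ ¬ ((m + 1) / 2 < Y 0 ω)
      rw [hX, not_lt]
      constructor <;> intro <;> linarith
    rw [h3, probReal_compl_eq_one_sub (measurableSet_lt measurable_const hY0),
      hY _ (by linarith), sub_pos]
    exact Real.rpow_lt_one_of_one_lt_of_neg (by linarith) (by linarith)
  have hB : ∀ᵐ ω ∂P, -m ≤ X 0 ω := by
    have h3 : P {ω | 1 < Y 0 ω} = 1 := by
      have := hY 1 le_rfl
      rw [Real.one_rpow, measureReal_def] at this
      rwa [ENNReal.toReal_eq_one_iff] at this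
    have h4 : ∀ᵐ ω ∂P, 1 < Y 0 ω :=
      (mem_ae_iff_prob_eq_one (measurableSet_lt measurable_const hY0)).2 h3
    filter_upwards [h4] with ω hω
    rw [hX]
    linarith
  have hE : SameOrder (fun n => ∫ ω, |partialSum X n ω| ∂P) (fun n => (n : ℝ) ^ (1 / α)) :=
    sameOrder_of_tendsto hL (fun n hn => hiid.integral_abs_partialSum_pos hXi hδ hq hn) hlim
  exact ⟨hiid, hYi, hXi, hXz, ⟨_, hL, hlim⟩, hE,
    hiid.sameOrder_persistenceProb hXi hXz (by linarith) hB hδ hq (by positivity)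
      ((div_lt_one hα).2 h1) hE⟩

theorem mainTheorem3 :
    -- every exponent in `(0, 1/4)` occurs
    (∀ γ : ℝ, 0 < γ → γ < 1 / 4 →
      ∃ (Ω : Type) (_ : MeasurableSpace Ω) (P : Measure Ω) (X : ℕ → Ω → ℝ),
        IsProbabilityMeasure P ∧ IsIIDSeq P X ∧
        Integrable (X 0) P ∧ ∫ ω, X 0 ω ∂P = 0 ∧
        SameOrder (fun n => persistenceProb P X n) (fun n => (n : ℝ) ^ (-γ))) ∧
    -- the explicit example of centred Pareto variables
    (∀ α : ℝ, 1 < α → α < 2 →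
      ∀ (Ω : Type*) (_ : MeasurableSpace Ω) (P : Measure Ω) (Y : ℕ → Ω → ℝ),
        IsProbabilityMeasure P → IsIIDSeq P Y →
        (∀ y : ℝ, 1 ≤ y → P.real {ω | y < Y 0 ω} = y ^ (-α)) →
        ∀ X : ℕ → Ω → ℝ, (∀ i ω, X i ω = Y i ω - ∫ ω', Y 0 ω' ∂P) →
          Integrable (Y 0) P ∧ Integrable (X 0) P ∧ ∫ ω, X 0 ω ∂P = 0 ∧
          (∃ L : ℝ, 0 < L ∧
            Tendsto (fun n : ℕ => (n : ℝ) ^ (-(1 / α)) * ∫ ω, |partialSum X n ω| ∂P)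
              atTop (𝓝 L)) ∧
          SameOrder (fun n => ∫ ω, |partialSum X n ω| ∂P) (fun n => (n : ℝ) ^ (1 / α)) ∧
          SameOrder (fun n => persistenceProb P X n)
            (fun n => (n : ℝ) ^ (-((1 - 1 / α) / 2)))) := by
  refine ⟨fun γ hγ hγ' => ?_, fun α h1 h2 Ω _ P Y hP h hY X hX =>
    (persistence_pareto h1 h2 h hY hX).2⟩
  -- Solution of `γ = (1 - 1 / α) / 2`; the range 0 < γ < 1/4 corresponds to 1 < α < 2.
  set α := 1 / (1 - 2 * γ) with hα
  have hpos : 0 < 1 - 2 * γ := by linarith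
  have h1 : 1 < α := by rw [hα, lt_div_iff₀ hpos]; linarith
  have h2 : α < 2 := by rw [hα, div_lt_iff₀ hpos]; linarith
  have hprob := isProbabilityMeasure_paretoMeasure (t := 1) one_pos (r := α) (by linarith)
  let P : Measure (ℕ → ℝ) := Measure.infinitePi fun _ => paretoMeasure 1 α
  let Y : ℕ → (ℕ → ℝ) → ℝ := fun i ω => ω i
  have hmap : ∀ i, P.map (Y i) = paretoMeasure 1 α := fun i => Measure.infinitePi_map_eval _ i
  have hmeas : ∀ i, Measurable (Y i) := fun i => measurable_pi_apply i
  have hiid : IsIIDSeq P Y :=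
    ⟨hmeas, iIndepFun_infinitePi (X := fun _ y => y) fun _ => measurable_id,
      fun i => ⟨(hmeas i).aemeasurable, (hmeas 0).aemeasurable, by rw [hmap, hmap]⟩⟩
  have hY : ∀ y : ℝ, 1 ≤ y → P.real {ω | y < Y 0 ω} = y ^ (-α) := fun y hy => by
    rw [← paretoMeasure_real_Ioi (by linarith) hy, ← hmap 0,
      map_measureReal_apply (hmeas 0) measurableSet_Ioi]
    rfl
  obtain ⟨hX, -, hXi, hXz, -, -, hp⟩ := persistence_pareto h1 h2 hiid hY
    (X := fun i ω => Y i ω - ∫ ω', Y 0 ω' ∂P) fun _ _ => rfl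
  refine ⟨_, _, P, _, inferInstance, hX, hXi, hXz, ?_⟩
  have hγα : (1 - 1 / α) / 2 = γ := by rw [hα, one_div_one_div]; ring
  rwa [hγα] at hp
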